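/- Let $n\ge 0$ be an integer and $u\in\mathbb C$. Let $\mathcal C[\xi_1,\dots,\xi_n]$ be the unital associative $\mathbb C$-algebra generated by $\xi_1,\dots,\xi_n$ subject to $\xi_i\xi_j=-\xi_j\xi_i$ for $i\ne j$. Let $\mathbb C S_n^-$ be the spin symmetric group algebra, i.e. the unital associative $\mathbb C$-algebra generated by $t_1,\dots,t_{n-1}$ subject to $$t_i^2=1,\qquad t_it_{i+1}t_i=t_{i+1}t_it_{i+1},\qquad t_it_j=-t_jt_i\quad(|i-j|>1),$$ and for $1\le i<j\le n$ put $$[i,j]=-[j,i]=(-1)^{j-i-1}\,t_{j-1}\cdots t_{i+1}\,t_i\,t_{i+1}\cdots t_{j-1}.$$ Let $\ddot{\mathfrak H}^-$ be the rational spin double affine Hecke algebra with parameter $u$, i.e. the unital associative $\mathbb C$-algebra generated by $\xi_i,y_i$ $(1\le i\le n)$ and $t_i$ $(1\le i\le n-1)$, subject to the above relations for the $t_i$ and to $$\xi_i\xi_j=-\xi_j\xi_i,\qquad y_iy_j=y_jy_i\qquad(i\ne j),$$ $$t_i\xi_i=-\xi_{i+1}t_i,\qquad t_iy_i=y_{i+1}t_i,$$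 $$t_j\xi_i=-\xi_it_j,\qquad t_jy_i=y_it_j\qquad(i\ne j,\,j+1),$$ $$y_i\xi_j-\xi_jy_i=u\,[i,j]\quad(i\ne j),\qquad y_i\xi_i-\xi_iy_i=u\sum_{k\ne i}[i,k].$$ Then the canonical algebra homomorphisms from $\mathcal C[\xi_1,\dots,\xi_n]$, $\mathbb C S_n^-$ and the polynomial algebra $\mathbb C[y_1,\dots,y_n]$ to $\ddot{\mathfrak H}^-$ (sending each generator to the generator of the same name) are injective, so that these three algebras are identified with subalgebras of $\ddot{\mathfrak H}^-$, and multiplication $f\otimes\sigma\otimes g\mapsto f\sigma g$ gives an isomorphism of vector spaces $$\mathcal C[\xi_1,\dots,\xi_n]\otimes\mathbb C S_n^-\otimes\mathbb C[y_1,\dots,y_n]\;\xrightarrow{\ \cong\ }\;\ddot{\mathfrak H}^-.$$ -/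

import Mathlib

open scoped TensorProduct

noncomputable section

namespace SpinDaHa

/-- Indices are zero-based: `ξ`, `y` carry an index in `Fin n`, and the generator `t i`,
`i : Fin (n - 1)`, corresponds to the adjacent transposition of `lo i = i` and `hi i = i + 1`. -/
def lo {n : ℕ} (i : Fin (n - 1)) : Fin n := ⟨i, by omega⟩

/-- The index `i + 1 : Fin n` attached to `i : Fin (n - 1)`. -/
def hi {n : ℕ} (i : Fin (n - 1)) : Fin n := ⟨i + 1, by omega⟩

/-! ### The odd transpositions -/

/-- The product `t_{i+d} ⋯ t_{i+1} t_i t_{i+1} ⋯ t_{i+d}`. -/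
def palindrome {n : ℕ} {A : Type*} [Mul A] (t : Fin (n - 1) → A) (i : ℕ) :
    (d : ℕ) → i + d < n - 1 → A
  | 0, h => t ⟨i, h⟩
  | d + 1, h => t ⟨i + (d + 1), h⟩ * palindrome t i d (by omega) * t ⟨i + (d + 1), h⟩

/-- The odd transposition
`[i, j] = (-1)^(j-i-1) t_{j-1} ⋯ t_{i+1} t_i t_{i+1} ⋯ t_{j-1}` for `i < j`, with
`[j, i] = - [i, j]`; here `t` is any family of elements of a ring. The value at `i = j` is
a placeholder that is never used. -/
def oddTransposition {n : ℕ} {A : Type*} [Ring A] (t : Fin (n - 1) → A) (i j : Fin n) : A :=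
  if h : i < j then
    (-1) ^ ((j : ℕ) - i - 1) * palindrome t i ((j : ℕ) - i - 1) (by omega)
  else if h' : j < i then
    -((-1) ^ ((i : ℕ) - j - 1) * palindrome t j ((i : ℕ) - j - 1) (by omega))
  else 0

/-! ### The spin symmetric group algebra -/

/-- Defining relations of the spin symmetric group algebra. -/
inductive SpinRel (n : ℕ) :
    FreeAlgebra ℂ (Fin (n - 1)) → FreeAlgebra ℂ (Fin (n - 1)) → Prop
  | sq (i : Fin (n - 1)) :
      SpinRel n (FreeAlgebra.ι ℂ i * FreeAlgebra.ι ℂ i) 1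
  | braid (i j : Fin (n - 1)) (h : (j : ℕ) = i + 1) :
      SpinRel n (FreeAlgebra.ι ℂ i * FreeAlgebra.ι ℂ j * FreeAlgebra.ι ℂ i)
        (FreeAlgebra.ι ℂ j * FreeAlgebra.ι ℂ i * FreeAlgebra.ι ℂ j)
  | anticomm (i j : Fin (n - 1)) (h : (i : ℕ) + 1 < j ∨ (j : ℕ) + 1 < i) :
      SpinRel n (FreeAlgebra.ι ℂ i * FreeAlgebra.ι ℂ j)
        (-(FreeAlgebra.ι ℂ j * FreeAlgebra.ι ℂ i))

/-- The spin symmetric group algebra `ℂ S_n^-`. -/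
abbrev SpinSym (n : ℕ) : Type := RingQuot (SpinRel n)

/-- The generator `t_i` of `ℂ S_n^-`. -/
def SpinSym.t {n : ℕ} (i : Fin (n - 1)) : SpinSym n :=
  RingQuot.mkAlgHom ℂ (SpinRel n) (FreeAlgebra.ι ℂ i)

/-! ### The skew polynomial algebra -/

/-- Defining relations of the skew polynomial algebra: distinct generators anticommute. -/
inductive SkewRel (n : ℕ) : FreeAlgebra ℂ (Fin n) → FreeAlgebra ℂ (Fin n) → Prop
  | anticomm (i j : Fin n) (h : i ≠ j) :
      SkewRel n (FreeAlgebra.ι ℂ i * FreeAlgebra.ι ℂ j)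
        (-(FreeAlgebra.ι ℂ j * FreeAlgebra.ι ℂ i))

/-- The skew polynomial algebra `𝒞[ξ_1, …, ξ_n]`. -/
abbrev SkewPoly (n : ℕ) : Type := RingQuot (SkewRel n)

/-- The generator `ξ_i` of `𝒞[ξ_1, …, ξ_n]`. -/
def SkewPoly.xi {n : ℕ} (i : Fin n) : SkewPoly n :=
  RingQuot.mkAlgHom ℂ (SkewRel n) (FreeAlgebra.ι ℂ i)

/-! ### The rational spin double affine Hecke algebra -/

/-- Names of the generators `ξ_i`, `y_i` (`1 ≤ i ≤ n`) and `t_i` (`1 ≤ i ≤ n - 1`). -/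
inductive Gen (n : ℕ) : Type
  | xi : Fin n → Gen n
  | y : Fin n → Gen n
  | t : Fin (n - 1) → Gen n

/-- The free generator `ξ_i`. -/
abbrev fxi {n : ℕ} (i : Fin n) : FreeAlgebra ℂ (Gen n) := FreeAlgebra.ι ℂ (Gen.xi i)

/-- The free generator `y_i`. -/
abbrev fy {n : ℕ} (i : Fin n) : FreeAlgebra ℂ (Gen n) := FreeAlgebra.ι ℂ (Gen.y i)

/-- The free generator `t_i`. -/
abbrev ft {n : ℕ} (i : Fin (n - 1)) : FreeAlgebra ℂ (Gen n) := FreeAlgebra.ι ℂ (Gen.t i)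

/-- Defining relations of the rational spin double affine Hecke algebra with parameter `u`. -/
inductive Rel (n : ℕ) (u : ℂ) : FreeAlgebra ℂ (Gen n) → FreeAlgebra ℂ (Gen n) → Prop
  | t_sq (i : Fin (n - 1)) : Rel n u (ft i * ft i) 1
  | t_braid (i j : Fin (n - 1)) (h : (j : ℕ) = i + 1) :
      Rel n u (ft i * ft j * ft i) (ft j * ft i * ft j)
  | t_anticomm (i j : Fin (n - 1)) (h : (i : ℕ) + 1 < j ∨ (j : ℕ) + 1 < i) :
      Rel n u (ft i * ft j) (-(ft j * ft i))
  | xi_anticomm (i j : Fin n) (h : i ≠ j) : Rel n u (fxi i * fxi j) (-(fxi j * fxi i))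
  | y_comm (i j : Fin n) (h : i ≠ j) : Rel n u (fy i * fy j) (fy j * fy i)
  | t_xi (i : Fin (n - 1)) : Rel n u (ft i * fxi (lo i)) (-(fxi (hi i) * ft i))
  | t_y (i : Fin (n - 1)) : Rel n u (ft i * fy (lo i)) (fy (hi i) * ft i)
  | t_xi_far (j : Fin (n - 1)) (i : Fin n) (h₁ : i ≠ lo j) (h₂ : i ≠ hi j) :
      Rel n u (ft j * fxi i) (-(fxi i * ft j))
  | t_y_far (j : Fin (n - 1)) (i : Fin n) (h₁ : i ≠ lo j) (h₂ : i ≠ hi j) :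
      Rel n u (ft j * fy i) (fy i * ft j)
  | y_xi (i j : Fin n) (h : i ≠ j) :
      Rel n u (fy i * fxi j - fxi j * fy i) (u • oddTransposition ft i j)
  | y_xi_self (i : Fin n) :
      Rel n u (fy i * fxi i - fxi i * fy i)
        (u • ∑ k ∈ Finset.univ.erase i, oddTransposition ft i k)

/-- The rational spin double affine Hecke algebra. -/
abbrev SDaHa (n : ℕ) (u : ℂ) : Type := RingQuot (Rel n u)

namespace SDaHa

variable {n : ℕ} (u : ℂ)

/-- The generator `ξ_i` of the spin double affine Hecke algebra. -/
def xi (i : Fin n) : SDaHa n u := RingQuot.mkAlgHom ℂ (Rel n u) (fxi i)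

/-- The generator `y_i` of the spin double affine Hecke algebra. -/
def y (i : Fin n) : SDaHa n u := RingQuot.mkAlgHom ℂ (Rel n u) (fy i)

/-- The generator `t_i` of the spin double affine Hecke algebra. -/
def t (i : Fin (n - 1)) : SDaHa n u := RingQuot.mkAlgHom ℂ (Rel n u) (ft i)

theorem y_mul_y (i j : Fin n) : y u i * y u j = y u j * y u i := by
  by_cases h : i = j
  · rw [h]
  · simpa only [y, map_mul] using RingQuot.mkAlgHom_rel ℂ (Rel.y_comm (u := u) i j h)

/-- The canonical algebra homomorphism `𝒞[ξ_1, …, ξ_n] → SDaHa n u`, `ξ_i ↦ ξ_i`. -/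
def ofSkewPoly : SkewPoly n →ₐ[ℂ] SDaHa n u :=
  RingQuot.liftAlgHom ℂ ⟨FreeAlgebra.lift ℂ (xi u), by
    intro a b h
    induction h with
    | anticomm i j h =>
      simpa only [xi, t, map_mul, map_neg, FreeAlgebra.lift_ι_apply] using
        RingQuot.mkAlgHom_rel ℂ (Rel.xi_anticomm (u := u) i j h)⟩

/-- The canonical algebra homomorphism `ℂ S_n^- → SDaHa n u`, `t_i ↦ t_i`. -/
def ofSpinSym : SpinSym n →ₐ[ℂ] SDaHa n u :=
  RingQuot.liftAlgHom ℂ ⟨FreeAlgebra.lift ℂ (t u), by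
    intro a b h
    induction h with
    | sq i =>
      simpa only [t, map_mul, map_one, FreeAlgebra.lift_ι_apply] using
        RingQuot.mkAlgHom_rel ℂ (Rel.t_sq (u := u) i)
    | braid i j h =>
      simpa only [t, map_mul, FreeAlgebra.lift_ι_apply] using
        RingQuot.mkAlgHom_rel ℂ (Rel.t_braid (u := u) i j h)
    | anticomm i j h =>
      simpa only [xi, t, map_mul, map_neg, FreeAlgebra.lift_ι_apply] using
        RingQuot.mkAlgHom_rel ℂ (Rel.t_anticomm (u := u) i j h)⟩

open scoped IsMulCommutative in
/-- The canonical algebra homomorphism `ℂ[y_1, …, y_n] → SDaHa n u`, `y_i ↦ y_i`. It is obtained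
through the commutative subalgebra generated by the `y_i`. -/
def ofPoly : MvPolynomial (Fin n) ℂ →ₐ[ℂ] SDaHa n u :=
  haveI : IsMulCommutative (Algebra.adjoin ℂ (Set.range (y u : Fin n → SDaHa n u))) :=
    Algebra.isMulCommutative_adjoin ℂ (by
      rintro _ ⟨i, rfl⟩ _ ⟨j, rfl⟩
      exact y_mul_y u i j)
  (Algebra.adjoin ℂ (Set.range (y u : Fin n → SDaHa n u))).val.comp
    (MvPolynomial.aeval
      (S₁ := Algebra.adjoin ℂ (Set.range (y u : Fin n → SDaHa n u))) fun i =>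
        ⟨y u i, Algebra.subset_adjoin (Set.mem_range_self i)⟩)

@[simp] theorem ofSkewPoly_xi (i : Fin n) : ofSkewPoly u (SkewPoly.xi i) = xi u i := by
  simp [ofSkewPoly, SkewPoly.xi]

@[simp] theorem ofSpinSym_t (i : Fin (n - 1)) : ofSpinSym u (SpinSym.t i) = t u i := by
  simp [ofSpinSym, SpinSym.t]

@[simp] theorem ofPoly_X (i : Fin n) : ofPoly u (MvPolynomial.X i) = y u i := by
  simp [ofPoly]

end SDaHa

end SpinDaHa

end

/-!
The multiplication map `f ⊗ σ ⊗ g ↦ f σ g` is surjective because its range contains `1` and is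
stable under left multiplication by all generators: `t_k` passes `f` by the automorphism
`ξ_i ↦ -ξ_{s_k i}`, and `y_i` passes `f` at the cost of the commutators `[y_i, ξ_j] = u C_{ij}`,
which lie in the span of products of the `t_k` (`SpinDaHa.SDaHa.mulMap_surjective`).

For injectivity, a representation is induced. Let `N` be a space on which the `t_k` and the `y_i`
act with their relations. On `𝒞[ξ] ⊗ N` let `ξ_i` act by multiplication, `t_k` diagonally, and
`y_i` by `y_i (f ⊗ v) = f ⊗ y_i v + D_i(f) (1 ⊗ v)`, where `D_i` is the operator-valued derivation
of `𝒞[ξ]` with `D_i(ξ_k) = u C_{ik}`. The derivation is encoded as an algebra homomorphism to dual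
numbers, and it exists by `SpinDaHa.bracket_anticomm`. The relations `t_k y_i = y_{s_k i} t_k` and
`y_i y_j = y_j y_i` hold on `1 ⊗ N`, and their defects pass through multiplication by the `ξ_j`, the
second one by the Jacobi identity `SpinDaHa.bracket_jacobi`; so they hold everywhere. Both
compatibilities come from the rule `t_k [i, j] = -[s_k i, s_k j] t_k`
(`SpinDaHa.IsSpinFamily.mul_oddTransposition`) and the resulting commutation of `[i, j]` with
families permuted by the `t_k`.

Taking `N = ℂ[y] ⊗ ℂ S_n^-`, the element `f σ g` sends `1 ⊗ 1 ⊗ 1` to `f ⊗ σ · (g ⊗ 1)`, and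
`σ ⊗ g ↦ σ · (g ⊗ 1)` has a left inverse, given by the right action of `ℂ S_n^-` on
`ℂ S_n^- ⊗ ℂ[y]` (`SpinDaHa.Straighten.straighten_leftAct`).

The three factors embed because each of them is nonzero. For `ℂ S_n^-` this is not visible from the
presentation; the normalised simple roots satisfy the relations of the `t_k` in a Clifford algebra.
-/

noncomputable section

namespace SpinDaHa

/-! ### Adjacent transpositions -/

/-- The adjacent transposition `s_k` of `lo k` and `hi k`. -/
def adj {n : ℕ} (k : Fin (n - 1)) : Equiv.Perm (Fin n) := Equiv.swap (lo k) (hi k)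

theorem adj_lo {n : ℕ} (k : Fin (n - 1)) : adj k (lo k) = hi k := Equiv.swap_apply_left _ _

theorem adj_hi {n : ℕ} (k : Fin (n - 1)) : adj k (hi k) = lo k := Equiv.swap_apply_right _ _

theorem adj_of_ne {n : ℕ} {k : Fin (n - 1)} {i : Fin n} (h₁ : i ≠ lo k) (h₂ : i ≠ hi k) :
    adj k i = i := Equiv.swap_apply_of_ne_of_ne h₁ h₂

theorem adj_mul_self {n : ℕ} (k : Fin (n - 1)) : adj k * adj k = 1 := Equiv.swap_mul_self _ _

theorem adj_adj {n : ℕ} (k : Fin (n - 1)) (i : Fin n) : adj k (adj k i) = i :=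
  Equiv.swap_apply_self _ _ _

theorem adj_braid {n : ℕ} {i j : Fin (n - 1)} (h : (j : ℕ) = i + 1) :
    adj i * adj j * adj i = adj j * adj i * adj j := by
  have e : lo j = hi i := Fin.ext h
  have h₁ : lo i ≠ hi i := by simp [lo, hi, Fin.ext_iff]
  have h₂ : lo i ≠ hi j := by simp only [lo, hi, ne_eq, Fin.ext_iff]; omega
  have h₃ : hi i ≠ hi j := by simp only [hi, ne_eq, Fin.ext_iff]; omega
  rw [adj, adj, e, Equiv.swap_mul_swap_mul_swap h₁ h₂, Equiv.swap_comm (lo i) (hi i),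
    Equiv.swap_comm (hi i) (hi j), Equiv.swap_mul_swap_mul_swap h₃.symm h₂.symm]
  exact Equiv.swap_comm _ _

theorem adj_commute {n : ℕ} {i j : Fin (n - 1)}
    (h : (i : ℕ) + 1 < j ∨ (j : ℕ) + 1 < i) : adj i * adj j = adj j * adj i := by
  refine (Equiv.Perm.Disjoint.commute ?_).eq
  rw [Equiv.Perm.disjoint_iff_disjoint_support, adj, adj, Equiv.Perm.support_swap,
    Equiv.Perm.support_swap]
  · simp [lo, hi, Fin.ext_iff]; omega
  · simp [lo, hi, Fin.ext_iff]
  · simp [lo, hi, Fin.ext_iff]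

/-! ### Odd transpositions in a ring -/

/-- A family of elements of a ring satisfying the defining relations of `ℂ S_n^-`. -/
structure IsSpinFamily {n : ℕ} {A : Type*} [Ring A] (t : Fin (n - 1) → A) : Prop where
  sq (i : Fin (n - 1)) : t i * t i = 1
  braid (i j : Fin (n - 1)) (h : (j : ℕ) = i + 1) : t i * t j * t i = t j * t i * t j
  anticomm (i j : Fin (n - 1)) (h : (i : ℕ) + 1 < j ∨ (j : ℕ) + 1 < i) :
    t i * t j = -(t j * t i)

section Calculus

variable {n : ℕ} {A : Type*} [Ring A] {t : Fin (n - 1) → A}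

theorem map_palindrome {B : Type*} [Ring B] (φ : A →+* B) (i d : ℕ) (h : i + d < n - 1) :
    φ (palindrome t i d h) = palindrome (fun k => φ (t k)) i d h := by
  induction d with
  | zero => rfl
  | succ d ih => simp only [palindrome, map_mul, ih]

theorem map_oddTransposition {B : Type*} [Ring B] (φ : A →+* B) (i j : Fin n) :
    φ (oddTransposition t i j) = oddTransposition (fun k => φ (t k)) i j := by
  unfold oddTransposition
  split_ifs <;> simp [map_palindrome]

theorem mul_conj_of_anticomm {x m p q : A} (c : x * m = -(m * x)) (e : x * p = q * x) :
    x * (m * p * m) = m * q * m * x :=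
  calc x * (m * p * m) = -(m * (x * p) * m) := by
        rw [mul_assoc m, ← mul_assoc x, c]; simp [mul_assoc]
    _ = m * q * -(x * m) := by rw [e]; simp [mul_assoc]
    _ = m * q * m * x := by rw [c, neg_neg, mul_assoc _ m]

namespace IsSpinFamily

theorem sq_mul (ht : IsSpinFamily t) (k : Fin (n - 1)) (a : A) : t k * (t k * a) = a := by
  rw [← mul_assoc, ht.sq, one_mul]

theorem mul_comm_of_mul_comm (ht : IsSpinFamily t) {k : Fin (n - 1)} {a b : A}
    (h : t k * a = b * t k) : t k * b = a * t k :=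
  calc t k * b = t k * (b * t k) * t k := by rw [mul_assoc, mul_assoc, ht.sq, mul_one]
    _ = a * t k := by rw [← h, ht.sq_mul]

theorem mul_anticomm_of_mul_anticomm (ht : IsSpinFamily t) {k : Fin (n - 1)} {a b : A}
    (h : t k * a = -(b * t k)) : t k * b = -(a * t k) := by
  rw [← ht.mul_comm_of_mul_comm (h.trans (neg_mul _ _).symm), mul_neg, neg_neg]

theorem mul_palindrome_far (ht : IsSpinFamily t) (k : Fin (n - 1)) (i d : ℕ) (h : i + d < n - 1)
    (hk : (k : ℕ) + 1 < i ∨ i + d + 1 < k) :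
    t k * palindrome t i d h = -(palindrome t i d h * t k) := by
  induction d with
  | zero => exact ht.anticomm _ _ (by simp only; omega)
  | succ d ih =>
    have e := ih (by omega) (by omega)
    have c := ht.anticomm k ⟨i + (d + 1), h⟩ (by simp only; omega)
    simp only [palindrome]
    rw [mul_conj_of_anticomm c (e.trans (neg_mul _ _).symm), mul_neg, neg_mul, neg_mul]

theorem mul_palindrome_succ (ht : IsSpinFamily t) (k : Fin (n - 1)) (i d : ℕ)
    (h : i + (d + 1) < n - 1) (hk : (k : ℕ) = i + (d + 1)) :
    t k * palindrome t i (d + 1) h = palindrome t i d (by omega) * t k := by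
  obtain rfl : k = ⟨i + (d + 1), h⟩ := Fin.ext hk
  simp only [palindrome]
  rw [mul_assoc, ht.sq_mul]

/-- The palindromes are defined by growth at the upper end; by the braid relation they grow at the
lower end in the same way. -/
theorem mul_palindrome_left (ht : IsSpinFamily t) (k : Fin (n - 1)) (d : ℕ)
    (h : (k : ℕ) + 1 + d < n - 1) :
    t k * palindrome t (k + 1) d h = palindrome t k (d + 1) (by omega) * t k := by
  induction d with
  | zero =>
    have b := ht.braid k ⟨k + 1, h⟩ rfl
    have : t k * palindrome t (k + 1) 0 h = t k * t ⟨k + 1, h⟩ * t k * t k := by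
      rw [mul_assoc _ (t k), ht.sq, mul_one]; rfl
    rw [this, b]
    rfl
  | succ d ih =>
    have e := ih (by omega)
    have hkd : (k : ℕ) + 1 + (d + 1) = k + (d + 1 + 1) := by omega
    have c := ht.anticomm k ⟨k + (d + 1 + 1), by omega⟩ (by simp only; omega)
    rw [palindrome, palindrome.eq_def t k]
    simp only [hkd]
    exact mul_conj_of_anticomm c e

/-- For `k`, `k + 1` strictly between the endpoints, `t_k` meets the palindrome in
`t_{k+1} t_k ⋯ t_k t_{k+1}`; two braid moves turn it into `t_{k+1}`, which anticommutes with the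
inner part. -/
theorem mul_palindrome_mid (ht : IsSpinFamily t) (k : Fin (n - 1)) (i d : ℕ) (h : i + d < n - 1)
    (h₁ : i < k) (h₂ : (k : ℕ) < i + d) :
    t k * palindrome t i d h = -(palindrome t i d h * t k) := by
  induction d with
  | zero => omega
  | succ d ih =>
    by_cases hd : (k : ℕ) = i + d
    · obtain ⟨d, rfl⟩ : ∃ e, d = e + 1 := ⟨d - 1, by omega⟩
      have hk : (⟨i + (d + 1), by omega⟩ : Fin (n - 1)) = k := Fin.ext hd.symm
      set m : Fin (n - 1) := ⟨i + (d + 1 + 1), by omega⟩ with hm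
      have b : t k * t m * t k = t m * t k * t m := ht.braid k m (by simp only [hm]; omega)
      have c := ht.mul_palindrome_far m i d (by omega) (by simp only [hm]; omega)
      have e : palindrome t i (d + 1 + 1) h
          = t m * (t k * palindrome t i d (by omega) * t k) * t m := by
        simp only [palindrome, hk, hm]
      generalize palindrome t i d _ = p at c e
      rw [e]
      calc t k * (t m * (t k * p * t k) * t m)
          = t k * t m * t k * p * t k * t m := by simp only [mul_assoc]
        _ = t m * t k * (t m * p) * t k * t m := by rw [b]; simp only [mul_assoc]
        _ = -(t m * t k * p * (t m * t k * t m)) := by rw [c]; simp [mul_assoc]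
        _ = _ := by rw [← b]; simp only [mul_assoc]
    · have e := ih (by omega) (by omega)
      have c := ht.anticomm k ⟨i + (d + 1), h⟩ (by simp only; omega)
      simp only [palindrome]
      rw [mul_conj_of_anticomm c (e.trans (neg_mul _ _).symm), mul_neg, neg_mul, neg_mul]

end IsSpinFamily

theorem oddTransposition_of_eq {i j : Fin n} (d : ℕ) (h : (j : ℕ) = i + d + 1) :
    oddTransposition t i j = (-1) ^ d * palindrome t i d (by omega) := by
  have hd : (j : ℕ) - i - 1 = d := by omega
  have hij : i < j := Fin.lt_def.2 (by omega)
  simp only [oddTransposition, hij, dite_true, hd]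

theorem oddTransposition_swap (i j : Fin n) :
    oddTransposition t j i = -oddTransposition t i j := by
  unfold oddTransposition
  rcases lt_trichotomy i j with h | rfl | h
  · simp [h, not_lt_of_gt h]
  · simp
  · simp [h, not_lt_of_gt h]

theorem IsSpinFamily.mul_oddTransposition_of_lt (ht : IsSpinFamily t) (k : Fin (n - 1))
    {i j : Fin n} (hij : i < j) :
    t k * oddTransposition t i j = -(oddTransposition t (adj k i) (adj k j) * t k) := by
  have hij' : (i : ℕ) < j := hij
  obtain ⟨d, hd⟩ : ∃ d : ℕ, (j : ℕ) = i + d + 1 := ⟨j - i - 1, by omega⟩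
  have signs (a b : A) (h : t k * a = -(b * t k)) (e : ℕ) :
      t k * ((-1) ^ e * a) = -((-1) ^ e * b * t k) := by
    rcases neg_one_pow_eq_or A e with h' | h' <;> simp [h', h]
  have signs' (a b : A) (h : t k * a = b * t k) (e : ℕ) :
      t k * ((-1) ^ e * a) = -((-1) ^ (e + 1) * b * t k) := by
    rcases neg_one_pow_eq_or A e with h' | h' <;> simp [pow_succ, h', h]
  have signs'' (a b : A) (h : t k * a = b * t k) (e : ℕ) :
      t k * ((-1) ^ (e + 1) * a) = -((-1) ^ e * b * t k) := by
    rcases neg_one_pow_eq_or A e with h' | h' <;> simp [pow_succ, h', h]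
  have fix (m : Fin n) (h₁ : (m : ℕ) ≠ k) (h₂ : (m : ℕ) ≠ k + 1) : adj k m = m :=
    adj_of_ne (fun h => h₁ (congrArg Fin.val h)) (fun h => h₂ (congrArg Fin.val h))
  have vlo : (lo k : ℕ) = k := rfl
  have vhi : (hi k : ℕ) = k + 1 := rfl
  rw [oddTransposition_of_eq d hd]
  -- the position of `k`, `k + 1` relative to `i < j`
  by_cases c₁ : (k : ℕ) + 1 < i ∨ (j : ℕ) < k
  · rw [fix i (by omega) (by omega), fix j (by omega) (by omega), oddTransposition_of_eq d hd]
    exact signs _ _ (ht.mul_palindrome_far _ _ _ _ (by omega)) d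
  by_cases c₂ : (k : ℕ) + 1 = i
  · obtain rfl : i = hi k := Fin.ext (by omega)
    rw [adj_hi, fix j (by omega) (by omega), oddTransposition_of_eq (d + 1) (by omega)]
    exact signs' _ _ (ht.mul_palindrome_left k d (by omega)) d
  by_cases c₃ : (k : ℕ) = i
  · obtain rfl : i = lo k := Fin.ext (by omega)
    rcases d with _ | d
    · obtain rfl : j = hi k := Fin.ext (by omega)
      rw [adj_lo, adj_hi, oddTransposition_swap (lo k), oddTransposition_of_eq 0 (by omega)]
      simp [palindrome, lo]
    · rw [adj_lo, fix j (by omega) (by omega), oddTransposition_of_eq d (by omega)]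
      exact signs'' _ _
        (ht.mul_comm_of_mul_comm (ht.mul_palindrome_left k d (by omega))) d
  by_cases c₄ : (k : ℕ) + 1 < j
  · rw [fix i (by omega) (by omega), fix j (by omega) (by omega), oddTransposition_of_eq d hd]
    exact signs _ _ (ht.mul_palindrome_mid _ _ _ _ (by omega) (by omega)) d
  by_cases c₅ : (k : ℕ) + 1 = j
  · obtain rfl : j = hi k := Fin.ext (by omega)
    obtain ⟨d, rfl⟩ : ∃ e, d = e + 1 := ⟨d - 1, by omega⟩
    rw [adj_hi, fix i (by omega) (by omega), oddTransposition_of_eq d (by omega)]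
    exact signs'' _ _ (ht.mul_palindrome_succ k i d (by omega) (by omega)) d
  · obtain rfl : j = lo k := Fin.ext (by omega)
    rw [adj_lo, fix i (by omega) (by omega), oddTransposition_of_eq (d + 1) (by omega)]
    exact signs' _ _
      (ht.mul_comm_of_mul_comm (ht.mul_palindrome_succ k i d (by omega) (by omega))) d

/-- Conjugation by `t_k` acts on odd transpositions as `s_k` does on the indices, up to a
sign. -/
theorem IsSpinFamily.mul_oddTransposition (ht : IsSpinFamily t) (k : Fin (n - 1))
    {i j : Fin n} (hij : i ≠ j) :
    t k * oddTransposition t i j = -(oddTransposition t (adj k i) (adj k j) * t k) := by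
  rcases hij.lt_or_gt with h | h
  · exact ht.mul_oddTransposition_of_lt k h
  · rw [oddTransposition_swap, oddTransposition_swap (adj k j), mul_neg,
      ht.mul_oddTransposition_of_lt k h, neg_mul]

theorem palindrome_mul {X : Fin n → A} {c : ℤ} (hc : c * c = 1)
    (hX : ∀ k i, t k * X i = c • (X (adj k i) * t k)) (i d : ℕ) (h : i + d < n - 1) (m : Fin n) :
    palindrome t i d h * X m =
      c • (X (Equiv.swap ⟨i, by omega⟩ ⟨i + d + 1, by omega⟩ m) * palindrome t i d h) := by
  induction d generalizing m with
  | zero => exact hX _ _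
  | succ d ih =>
    set k : Fin (n - 1) := ⟨i + (d + 1), h⟩ with hk
    have e := ih (by omega)
    have conj : adj k (Equiv.swap ⟨i, by omega⟩ ⟨i + d + 1, by omega⟩ (adj k m)) =
        Equiv.swap ⟨i, by omega⟩ ⟨i + (d + 1) + 1, by omega⟩ m := by
      have h₁ : adj k ⟨i, by omega⟩ = ⟨i, by omega⟩ :=
        adj_of_ne (by simp [lo, hk]) (by simp [hi, hk]; omega)
      have h₂ : adj k ⟨i + d + 1, by omega⟩ = ⟨i + (d + 1) + 1, by omega⟩ := adj_lo k
      conv_rhs => rw [← h₁, ← h₂, Equiv.swap_apply_apply]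
      rw [adj, Equiv.swap_inv]
      rfl
    simp only [palindrome]
    change t k * _ * t k * _ = c • (_ * (t k * _ * t k))
    generalize palindrome t i d _ = p at e
    calc t k * p * t k * X m = c • (t k * (p * X (adj k m)) * t k) := by
          rw [mul_assoc, hX]; simp only [mul_smul_comm, mul_assoc]
      _ = t k * X (Equiv.swap ⟨i, by omega⟩ ⟨i + d + 1, by omega⟩ (adj k m)) * p * t k := by
          rw [e, mul_smul_comm, smul_mul_assoc, smul_smul, hc, one_smul]; simp only [mul_assoc]
      _ = _ := by rw [hX, conj]; simp only [smul_mul_assoc, mul_assoc]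

/-- If every `t_k` permutes a family `X` by conjugation up to the sign `c`, then so does every odd
transposition. -/
theorem oddTransposition_mul {X : Fin n → A} {c : ℤ} (hc : c * c = 1)
    (hX : ∀ k i, t k * X i = c • (X (adj k i) * t k)) {i j : Fin n} (hij : i ≠ j) (m : Fin n) :
    oddTransposition t i j * X m = c • (X (Equiv.swap i j m) * oddTransposition t i j) := by
  wlog h : i < j generalizing i j
  · rw [oddTransposition_swap, neg_mul, this hij.symm (lt_of_le_of_ne (not_lt.1 h) hij.symm),
      Equiv.swap_comm, mul_neg, smul_neg]
  have h' : (i : ℕ) < j := h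
  obtain ⟨d, hd⟩ : ∃ d : ℕ, (j : ℕ) = i + d + 1 := ⟨j - i - 1, by omega⟩
  have hj : (⟨i + d + 1, by omega⟩ : Fin n) = j := Fin.ext hd.symm
  rw [oddTransposition_of_eq d hd, mul_assoc, palindrome_mul hc hX, hj]
  rcases neg_one_pow_eq_or A d with h' | h' <;> simp [h']

end Calculus

/-! ### The commutators of `y_i` and `ξ_j` -/

section Bracket

variable {n : ℕ} {A : Type*} [Ring A] {t : Fin (n - 1) → A}

/-- The element `C_{ij}` with `y_i ξ_j - ξ_j y_i = u C_{ij}`: the odd transposition `[i, j]` for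
`i ≠ j`, and `∑_{k ≠ i} [i, k]` for `i = j`. -/
def bracket (t : Fin (n - 1) → A) (i j : Fin n) : A :=
  if i = j then ∑ k ∈ Finset.univ.erase i, oddTransposition t i k else oddTransposition t i j

theorem bracket_self (i : Fin n) :
    bracket t i i = ∑ k ∈ Finset.univ.erase i, oddTransposition t i k := if_pos rfl

theorem bracket_of_ne {i j : Fin n} (h : i ≠ j) : bracket t i j = oddTransposition t i j :=
  if_neg h

theorem map_bracket {B : Type*} [Ring B] (φ : A →+* B) (i j : Fin n) :
    φ (bracket t i j) = bracket (fun k => φ (t k)) i j := by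
  unfold bracket
  split_ifs <;> simp [map_oddTransposition]

theorem IsSpinFamily.mul_bracket (ht : IsSpinFamily t) (k : Fin (n - 1)) (i j : Fin n) :
    t k * bracket t i j = -(bracket t (adj k i) (adj k j) * t k) := by
  by_cases h : i = j
  · subst h
    rw [bracket_self, bracket_self, Finset.mul_sum, Finset.sum_mul, ← Finset.sum_neg_distrib]
    refine Finset.sum_equiv (adj k) (by simp) fun l hl => ?_
    exact ht.mul_oddTransposition k (Finset.ne_of_mem_erase hl).symm
  · rw [bracket_of_ne h, bracket_of_ne (by simpa using h), ht.mul_oddTransposition k h]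

section Stable

variable [Algebra ℂ A] {p : Submodule ℂ A}

theorem palindrome_mul_mem (h : ∀ k, ∀ b ∈ p, t k * b ∈ p) (i d : ℕ) (hd : i + d < n - 1) {b : A}
    (hb : b ∈ p) : palindrome t i d hd * b ∈ p := by
  induction d generalizing b with
  | zero => exact h _ b hb
  | succ d ih =>
    rw [palindrome, mul_assoc, mul_assoc]
    exact h _ _ (ih _ (h _ b hb))

theorem oddTransposition_mul_mem (h : ∀ k, ∀ b ∈ p, t k * b ∈ p) (i j : Fin n) {b : A}
    (hb : b ∈ p) : oddTransposition t i j * b ∈ p := by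
  wlog hij : i < j generalizing i j
  · rcases (not_lt.1 hij).eq_or_lt with rfl | hij
    · simp [oddTransposition]
    · rw [oddTransposition_swap, neg_mul]
      exact neg_mem (this j i hij)
  have hij' : (i : ℕ) < j := hij
  obtain ⟨d, hd⟩ : ∃ d : ℕ, (j : ℕ) = i + d + 1 := ⟨j - i - 1, by omega⟩
  have := palindrome_mul_mem h i d (by omega) hb
  rw [oddTransposition_of_eq d hd, mul_assoc]
  rcases neg_one_pow_eq_or A d with hs | hs
  · simpa [hs] using this
  · simpa [hs] using neg_mem this

/-- A subspace stable under left multiplication by the `t_k` is stable under left multiplication by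
the `C_{ij}`. -/
theorem bracket_mul_mem (h : ∀ k, ∀ b ∈ p, t k * b ∈ p) (i j : Fin n) {b : A} (hb : b ∈ p) :
    bracket t i j * b ∈ p := by
  unfold bracket
  split_ifs
  · rw [Finset.sum_mul]
    exact sum_mem fun k _ => oddTransposition_mul_mem h i k hb
  · exact oddTransposition_mul_mem h i j hb

end Stable

section Odd

variable {X : Fin n → A}

theorem oddTransposition_mul_odd (hX : ∀ k i, t k * X i = -(X (adj k i) * t k)) {i j : Fin n}
    (hij : i ≠ j) (m : Fin n) :
    oddTransposition t i j * X m = -(X (Equiv.swap i j m) * oddTransposition t i j) := by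
  simpa using oddTransposition_mul (t := t) (X := X) (c := -1) (by norm_num)
    (fun k i => by rw [hX]; simp) hij m

theorem bracket_self_anticomm (hX : ∀ k i, t k * X i = -(X (adj k i) * t k)) {i k : Fin n}
    (hik : i ≠ k) :
    bracket t i i * X k + X k * bracket t i i = (X k - X i) * oddTransposition t i k := by
  rw [bracket_self, Finset.sum_mul, Finset.mul_sum, ← Finset.sum_add_distrib,
    Finset.sum_eq_single k]
  · rw [oddTransposition_mul_odd hX hik, Equiv.swap_apply_right]
    noncomm_ring
  · intro l hl hlk
    rw [oddTransposition_mul_odd hX (Finset.ne_of_mem_erase hl).symm,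
      Equiv.swap_apply_of_ne_of_ne hik.symm hlk.symm, neg_add_cancel]
  · intro h
    exact absurd (Finset.mem_erase.2 ⟨hik.symm, Finset.mem_univ _⟩) h

/-- The compatibility of `[y_i, ξ_j] = u C_{ij}` with the anticommutation of the `ξ_j`. -/
theorem bracket_anticomm (hX : ∀ k i, t k * X i = -(X (adj k i) * t k)) (i : Fin n) {j k : Fin n}
    (hjk : j ≠ k) :
    X j * bracket t i k + bracket t i j * X k = -(X k * bracket t i j + bracket t i k * X j) := by
  suffices h : (bracket t i j * X k + X k * bracket t i j) +
      (bracket t i k * X j + X j * bracket t i k) = 0 by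
    rw [eq_neg_iff_add_eq_zero, ← h]; abel
  have diag {i k : Fin n} (hik : i ≠ k) : bracket t i k * X i + X i * bracket t i k =
      -((X k - X i) * oddTransposition t i k) := by
    rw [bracket_of_ne hik, oddTransposition_mul_odd hX hik, Equiv.swap_apply_left]
    noncomm_ring
  have off {i j k : Fin n} (hij : i ≠ j) (hik : i ≠ k) (hjk : j ≠ k) :
      bracket t i j * X k + X k * bracket t i j = 0 := by
    rw [bracket_of_ne hij, oddTransposition_mul_odd hX hij,
      Equiv.swap_apply_of_ne_of_ne hik.symm hjk.symm, neg_add_cancel]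
  by_cases hij : i = j
  · subst hij
    rw [bracket_self_anticomm hX hjk, diag hjk, add_neg_cancel]
  by_cases hik : i = k
  · subst hik
    rw [bracket_self_anticomm hX hij, diag hij, neg_add_cancel]
  · rw [off hij hik hjk, off hik hij hjk.symm, add_zero]

end Odd

section Even

variable {Y : Fin n → A}

theorem oddTransposition_mul_even (hY : ∀ k i, t k * Y i = Y (adj k i) * t k) {i j : Fin n}
    (hij : i ≠ j) (m : Fin n) :
    oddTransposition t i j * Y m = Y (Equiv.swap i j m) * oddTransposition t i j := by
  simpa using oddTransposition_mul (t := t) (X := Y) (c := 1) (by norm_num)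
    (fun k i => by rw [hY]; simp) hij m

theorem bracket_self_commutator (hY : ∀ k i, t k * Y i = Y (adj k i) * t k) {i j : Fin n}
    (hij : i ≠ j) :
    Y j * bracket t i i - bracket t i i * Y j = (Y j - Y i) * oddTransposition t i j := by
  rw [bracket_self, Finset.sum_mul, Finset.mul_sum, ← Finset.sum_sub_distrib,
    Finset.sum_eq_single j]
  · rw [oddTransposition_mul_even hY hij, Equiv.swap_apply_right, sub_mul]
  · intro l hl hlj
    rw [oddTransposition_mul_even hY (Finset.ne_of_mem_erase hl).symm,
      Equiv.swap_apply_of_ne_of_ne hij.symm hlj.symm, sub_self]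
  · intro h
    exact absurd (Finset.mem_erase.2 ⟨hij.symm, Finset.mem_univ _⟩) h

/-- The compatibility of `[y_i, ξ_j] = u C_{ij}` with the commutation of the `y_i`: the Jacobi
identity for `y_i`, `y_j` and `ξ_k`. -/
theorem bracket_jacobi (hY : ∀ k i, t k * Y i = Y (adj k i) * t k) (i j k : Fin n) :
    Y i * bracket t j k - bracket t j k * Y i = Y j * bracket t i k - bracket t i k * Y j := by
  have diag {i j : Fin n} (hij : i ≠ j) : Y i * bracket t j i - bracket t j i * Y i =
      (Y j - Y i) * oddTransposition t i j := by
    rw [bracket_of_ne hij.symm, oddTransposition_mul_even hY hij.symm, Equiv.swap_apply_right,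
      oddTransposition_swap i j]
    noncomm_ring
  have off {i j k : Fin n} (hij : i ≠ j) (hik : i ≠ k) (hjk : j ≠ k) :
      Y i * bracket t j k - bracket t j k * Y i = 0 := by
    rw [bracket_of_ne hjk, oddTransposition_mul_even hY hjk,
      Equiv.swap_apply_of_ne_of_ne hij hik, sub_self]
  by_cases hij : i = j
  · rw [hij]
  by_cases hik : i = k
  · subst hik
    rw [diag hij, bracket_self_commutator hY hij]
  by_cases hjk : j = k
  · subst hjk
    rw [diag (Ne.symm hij), bracket_self_commutator hY (Ne.symm hij)]
  · rw [off hij hik hjk, off (Ne.symm hij) hjk hik]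

end Even

end Bracket

/-! ### The skew polynomial algebra -/

/-- A subspace of an algebra given by generators and relations is everything as soon as it contains
`1` and is stable under left multiplication by the generators. -/
theorem submodule_eq_top {S : Type*} {r : FreeAlgebra ℂ S → FreeAlgebra ℂ S → Prop}
    {p : Submodule ℂ (RingQuot r)} (one : 1 ∈ p)
    (mul : ∀ s, ∀ a ∈ p, RingQuot.mkAlgHom ℂ r (FreeAlgebra.ι ℂ s) * a ∈ p) : p = ⊤ := by
  have key (b : FreeAlgebra ℂ S) : ∀ a ∈ p, RingQuot.mkAlgHom ℂ r b * a ∈ p := by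
    induction b using FreeAlgebra.induction with
    | grade0 c =>
      intro a ha
      rw [AlgHom.commutes, ← Algebra.smul_def]
      exact p.smul_mem c ha
    | grade1 s => exact mul s
    | mul b c hb hc =>
      intro a ha
      rw [map_mul, mul_assoc]
      exact hb _ (hc a ha)
    | add b c hb hc =>
      intro a ha
      rw [map_add, add_mul]
      exact p.add_mem (hb a ha) (hc a ha)
  refine Submodule.eq_top_iff'.2 fun a => ?_
  obtain ⟨b, rfl⟩ := RingQuot.mkAlgHom_surjective ℂ r a
  simpa using key b 1 one

namespace SkewPoly

variable {n : ℕ}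

theorem xi_anticomm {i j : Fin n} (h : i ≠ j) : xi i * xi j = -(xi j * xi i) := by
  simpa only [xi, map_mul, map_neg] using RingQuot.mkAlgHom_rel ℂ (SkewRel.anticomm i j h)

/-- The universal property of the skew polynomial algebra. -/
def lift {A : Type*} [Ring A] [Algebra ℂ A] (X : Fin n → A)
    (hX : ∀ i j, i ≠ j → X i * X j = -(X j * X i)) : SkewPoly n →ₐ[ℂ] A :=
  RingQuot.liftAlgHom ℂ ⟨FreeAlgebra.lift ℂ X, by
    intro a b h
    induction h with
    | anticomm i j h =>
      simpa only [map_mul, map_neg, FreeAlgebra.lift_ι_apply] using hX i j h⟩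

@[simp] theorem lift_xi {A : Type*} [Ring A] [Algebra ℂ A] (X : Fin n → A)
    (hX : ∀ i j, i ≠ j → X i * X j = -(X j * X i)) (i : Fin n) : lift X hX (xi i) = X i := by
  simp [lift, xi]

theorem algHom_ext {A : Type*} [Semiring A] [Algebra ℂ A] {φ ψ : SkewPoly n →ₐ[ℂ] A}
    (h : ∀ i, φ (xi i) = ψ (xi i)) : φ = ψ := by
  apply RingQuot.ringQuot_ext'
  ext i
  exact h i

instance : Nontrivial (SkewPoly n) :=
  (lift (fun _ => (0 : ℂ)) (by simp) : SkewPoly n →ₐ[ℂ] ℂ).toRingHom.domain_nontrivial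

/-- The algebra endomorphism `ξ_i ↦ c ξ_{w i}` of the skew polynomial algebra. -/
def twist (w : Equiv.Perm (Fin n)) (c : ℂ) : SkewPoly n →ₐ[ℂ] SkewPoly n :=
  lift (fun i => c • xi (w i)) fun i j h => by
    simp only [smul_mul_smul_comm, xi_anticomm (w.injective.ne h), smul_neg]

@[simp] theorem twist_xi (w : Equiv.Perm (Fin n)) (c : ℂ) (i : Fin n) :
    twist w c (xi i) = c • xi (w i) := lift_xi _ _ i

theorem twist_comp (v w : Equiv.Perm (Fin n)) (c d : ℂ) :
    (twist v c).comp (twist w d) = twist (v * w) (d * c) := by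
  refine algHom_ext fun i => ?_
  simp [smul_smul]

theorem twist_one : twist (1 : Equiv.Perm (Fin n)) 1 = AlgHom.id ℂ _ := by
  refine algHom_ext fun i => ?_
  simp

end SkewPoly

/-! ### The induced representation -/

/-- Elements of a ring satisfying the relations between the `t_k` and the `y_i`. -/
structure IsSpinPolyRep {n : ℕ} {A : Type*} [Ring A] (t : Fin (n - 1) → A) (y : Fin n → A) :
    Prop extends IsSpinFamily t where
  y_comm (i j : Fin n) : y i * y j = y j * y i
  t_y (k : Fin (n - 1)) (i : Fin n) : t k * y i = y (adj k i) * t k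

namespace Induced

variable {n : ℕ} {N : Type*} [AddCommGroup N] [Module ℂ N]

/-- The group structure underlying the vector space `𝒞[ξ_1, …, ξ_n] ⊗ N`, chosen so that its
addition is syntactically that of the tensor product. -/
instance : AddCommGroup (SkewPoly n ⊗[ℂ] N) := Module.addCommMonoidToAddCommGroup ℂ

variable (N) in
/-- Multiplication by `f` on the induced module `𝒞[ξ_1, …, ξ_n] ⊗ N`. -/
def mulOp : SkewPoly n →ₐ[ℂ] Module.End ℂ (SkewPoly n ⊗[ℂ] N) :=
  (Module.End.rTensorAlgHom ℂ _ _).comp (Algebra.lmul ℂ (SkewPoly n))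

@[simp] theorem mulOp_tmul (f g : SkewPoly n) (v : N) : mulOp N f (g ⊗ₜ v) = (f * g) ⊗ₜ v := rfl

variable (N) in
/-- The operator `ξ_i` on the induced module. -/
def xiOp (i : Fin n) : Module.End ℂ (SkewPoly n ⊗[ℂ] N) := mulOp N (SkewPoly.xi i)

@[simp] theorem xiOp_tmul (i : Fin n) (g : SkewPoly n) (v : N) :
    xiOp N i (g ⊗ₜ v) = (SkewPoly.xi i * g) ⊗ₜ v := rfl

/-- The operator `t_k` on the induced module. -/
def tOp (t : Fin (n - 1) → Module.End ℂ N) (k : Fin (n - 1)) :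
    Module.End ℂ (SkewPoly n ⊗[ℂ] N) :=
  TensorProduct.map (SkewPoly.twist (adj k) (-1)).toLinearMap (t k)

@[simp] theorem tOp_tmul (t : Fin (n - 1) → Module.End ℂ N) (k : Fin (n - 1)) (g : SkewPoly n)
    (v : N) : tOp t k (g ⊗ₜ v) = SkewPoly.twist (adj k) (-1) g ⊗ₜ t k v := rfl

/-- Operators on the induced module agree as soon as they agree on `1 ⊗ N` and their difference
commutes with the `ξ_i` up to a common scalar. -/
theorem end_eq {P Q : Module.End ℂ (SkewPoly n ⊗[ℂ] N)} (w : Fin n → Fin n) (c : ℂ)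
    (one : ∀ v, P (1 ⊗ₜ v) = Q (1 ⊗ₜ v))
    (mul : ∀ i, P * xiOp N i - Q * xiOp N i = c • (xiOp N (w i) * (P - Q))) : P = Q := by
  let p : Submodule ℂ (SkewPoly n) :=
    { carrier := {f | ∀ v, (P - Q) (f ⊗ₜ v) = 0}
      zero_mem' := by simp
      add_mem' := fun {a b} ha hb v => by rw [TensorProduct.add_tmul, map_add, ha, hb, add_zero]
      smul_mem' := fun c a ha v => by rw [← TensorProduct.smul_tmul', map_smul, ha, smul_zero] }
  have hp : p = ⊤ := by
    refine submodule_eq_top (fun v => by simp [one]) fun i a ha v => ?_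
    have := LinearMap.congr_fun (mul i) (a ⊗ₜ v)
    rw [← sub_mul] at this
    refine this.trans ?_
    rw [LinearMap.smul_apply, Module.End.mul_apply, ha, map_zero, smul_zero]
  refine TensorProduct.ext' fun f v => sub_eq_zero.1 ?_
  exact (hp ▸ Submodule.mem_top : f ∈ p) v

theorem tOp_mul_xiOp (t : Fin (n - 1) → Module.End ℂ N) (k : Fin (n - 1)) (i : Fin n) :
    tOp t k * xiOp N i = -(xiOp N (adj k i) * tOp t k) := by
  refine TensorProduct.ext' fun f v => ?_
  simp only [Module.End.mul_apply, LinearMap.neg_apply, xiOp_tmul, tOp_tmul, map_mul,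
    SkewPoly.twist_xi, smul_mul_assoc, ← TensorProduct.smul_tmul', neg_one_smul]

theorem xiOp_anticomm {i j : Fin n} (h : i ≠ j) :
    xiOp N i * xiOp N j = -(xiOp N j * xiOp N i) := by
  simp only [xiOp, ← map_mul, ← map_neg, SkewPoly.xi_anticomm h]

theorem tOp_mul_tOp (t : Fin (n - 1) → Module.End ℂ N) (k l : Fin (n - 1)) :
    tOp t k * tOp t l =
      TensorProduct.map (SkewPoly.twist (adj k * adj l) 1).toLinearMap (t k * t l) := by
  refine TensorProduct.ext' fun f v => ?_
  have := DFunLike.congr_fun (SkewPoly.twist_comp (adj k) (adj l) (-1) (-1)) f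
  simp only [AlgHom.comp_apply] at this
  simp [this]

theorem tOp_mul_tOp_mul_tOp (t : Fin (n - 1) → Module.End ℂ N) (k l m : Fin (n - 1)) :
    tOp t k * tOp t l * tOp t m =
      TensorProduct.map (SkewPoly.twist (adj k * adj l * adj m) (-1)).toLinearMap
        (t k * t l * t m) := by
  rw [tOp_mul_tOp]
  refine TensorProduct.ext' fun f v => ?_
  have := DFunLike.congr_fun (SkewPoly.twist_comp (adj k * adj l) (adj m) 1 (-1)) f
  simp only [AlgHom.comp_apply] at this
  simp [this]

theorem isSpinFamily_tOp {t : Fin (n - 1) → Module.End ℂ N} (ht : IsSpinFamily t) :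
    IsSpinFamily (tOp t) where
  sq i := by
    rw [tOp_mul_tOp, ht.sq, adj_mul_self, SkewPoly.twist_one]
    exact TensorProduct.map_id
  braid i j h := by
    rw [tOp_mul_tOp_mul_tOp, tOp_mul_tOp_mul_tOp, adj_braid h, ht.braid i j h]
  anticomm i j h := by
    rw [tOp_mul_tOp, tOp_mul_tOp, adj_commute h, ht.anticomm i j h]
    refine TensorProduct.ext' fun f v => ?_
    rw [LinearMap.neg_apply, TensorProduct.map_tmul, TensorProduct.map_tmul, LinearMap.neg_apply,
      ← neg_one_smul ℂ ((t j * t i) v), TensorProduct.tmul_smul]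
    exact neg_one_smul ℂ (_ : SkewPoly n ⊗[ℂ] N)

variable {t : Fin (n - 1) → Module.End ℂ N} {y : Fin n → Module.End ℂ N}

variable (t) in
/-- The algebra homomorphism `f ↦ f + ε [y_i, f]`, where `[y_i, f]` acts on the induced module. Its
`ε`-part is the unique derivation along `f ↦ f` with `ξ_k ↦ u C_{ik}`. -/
def derivHom (u : ℂ) (i : Fin n) :
    SkewPoly n →ₐ[ℂ] DualNumber (Module.End ℂ (SkewPoly n ⊗[ℂ] N)) :=
  SkewPoly.lift
    (fun k => TrivSqZeroExt.inl (xiOp N k) + TrivSqZeroExt.inr (u • bracket (tOp t) i k)) <| by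
    intro j k hjk
    ext1
    · simpa using xiOp_anticomm hjk
    · have := bracket_anticomm (tOp_mul_xiOp t) i hjk
      simp only [DualNumber.snd_mul, TrivSqZeroExt.snd_neg, TrivSqZeroExt.fst_add,
        TrivSqZeroExt.snd_add, TrivSqZeroExt.fst_inl, TrivSqZeroExt.snd_inl,
        TrivSqZeroExt.fst_inr, TrivSqZeroExt.snd_inr, add_zero, zero_add, mul_smul_comm,
        smul_mul_assoc, ← smul_add, this, smul_neg]

theorem fst_derivHom (u : ℂ) (i : Fin n) (f : SkewPoly n) :
    (derivHom t u i f).fst = mulOp N f := by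
  have : (TrivSqZeroExt.fstHom ℂ _ _).comp (derivHom t u i) = mulOp N := by
    refine SkewPoly.algHom_ext fun k => ?_
    simp [derivHom, xiOp]
  exact DFunLike.congr_fun this f

variable (t y) in
/-- The operator `y_i` on the induced module: `y_i (f ⊗ v) = f ⊗ y_i v + [y_i, f] (1 ⊗ v)`. -/
def yOp (u : ℂ) (i : Fin n) : Module.End ℂ (SkewPoly n ⊗[ℂ] N) :=
  LinearMap.lTensor _ (y i) + TensorProduct.lift (LinearMap.mk₂ ℂ
    (fun f v => (derivHom t u i f).snd (1 ⊗ₜ v))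
    (fun f g v => by simp) (fun c f v => by simp)
    (fun f v w => by simp [TensorProduct.tmul_add]) (fun c f v => by simp))

theorem yOp_tmul (u : ℂ) (i : Fin n) (f : SkewPoly n) (v : N) :
    yOp t y u i (f ⊗ₜ v) = f ⊗ₜ y i v + (derivHom t u i f).snd (1 ⊗ₜ v) := rfl

theorem yOp_one_tmul (u : ℂ) (i : Fin n) (v : N) : yOp t y u i (1 ⊗ₜ v) = 1 ⊗ₜ y i v := by
  simp [yOp_tmul]

theorem yOp_mul_xiOp (u : ℂ) (i k : Fin n) :
    yOp t y u i * xiOp N k = xiOp N k * yOp t y u i + u • bracket (tOp t) i k := by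
  refine TensorProduct.ext' fun f v => ?_
  have h : (derivHom t u i (SkewPoly.xi k * f)).snd =
      xiOp N k * (derivHom t u i f).snd + u • bracket (tOp t) i k * mulOp N f := by
    rw [map_mul, DualNumber.snd_mul, fst_derivHom, fst_derivHom]
    simp [derivHom, xiOp]
  simp only [Module.End.mul_apply, xiOp_tmul, yOp_tmul, h, LinearMap.add_apply, map_add,
    mulOp_tmul, mul_one, add_assoc]

/-- With `T = t_k`, `X = ξ_j`, `Y = y_i` and primes for the indices moved by `s_k`: the defect of
`T Y = Y' T` passes through the `ξ_j`. -/
theorem intertwine_defect {A : Type*} [Ring A] [Algebra ℂ A] {T X X' Y Y' C C' : A} {u : ℂ}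
    (hY : Y * X = X * Y + u • C) (hY' : Y' * X' = X' * Y' + u • C') (hX : T * X = -(X' * T))
    (hC : T * C = -(C' * T)) :
    T * Y * X - Y' * T * X = (-1 : ℂ) • (X' * (T * Y - Y' * T)) := by
  have h₁ : T * Y * X = -(X' * (T * Y)) - u • (C' * T) := by
    rw [mul_assoc, hY, mul_add, ← mul_assoc, hX, mul_smul_comm, hC, smul_neg, neg_mul, mul_assoc,
      sub_eq_add_neg]
  have h₂ : Y' * T * X = -(X' * (Y' * T)) - u • (C' * T) := by
    rw [mul_assoc, hX, mul_neg, ← mul_assoc, hY', add_mul, smul_mul_assoc, neg_add, mul_assoc,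
      sub_eq_add_neg]
  rw [h₁, h₂, neg_one_smul, mul_sub]
  abel

/-- With `X = ξ_k`, `Y = y_i`, `Y' = y_j`: by the Jacobi identity the commutator of `Y` and `Y'`
passes through the `ξ_k`. -/
theorem commute_defect {A : Type*} [Ring A] [Algebra ℂ A] {X Y Y' C C' : A} {u : ℂ}
    (hY : Y * X = X * Y + u • C) (hY' : Y' * X = X * Y' + u • C')
    (hC : Y * C' - C' * Y = Y' * C - C * Y') :
    Y * Y' * X - Y' * Y * X = (1 : ℂ) • (X * (Y * Y' - Y' * Y)) := by
  have h₁ : Y * Y' * X = X * (Y * Y') + u • (C * Y') + u • (Y * C') := by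
    rw [mul_assoc, hY', mul_add, ← mul_assoc, hY, add_mul, mul_smul_comm, smul_mul_assoc, mul_assoc]
  have h₂ : Y' * Y * X = X * (Y' * Y) + u • (C' * Y) + u • (Y' * C) := by
    rw [mul_assoc, hY, mul_add, ← mul_assoc, hY', add_mul, mul_smul_comm, smul_mul_assoc, mul_assoc]
  have h₃ : u • (Y * C') - u • (C' * Y) = u • (Y' * C) - u • (C * Y') := by
    rw [← smul_sub, hC, smul_sub]
  rw [h₁, h₂, one_smul, mul_sub, sub_eq_iff_eq_add.1 h₃]
  abel

theorem tOp_mul_yOp (h : IsSpinPolyRep t y) (u : ℂ) (k : Fin (n - 1)) (i : Fin n) :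
    tOp t k * yOp t y u i = yOp t y u (adj k i) * tOp t k := by
  refine end_eq (adj k) (-1) (fun v => ?_) fun j => ?_
  · have := LinearMap.congr_fun (h.t_y k i) v
    simp only [Module.End.mul_apply] at this
    simp [yOp_one_tmul, this]
  · exact intertwine_defect (yOp_mul_xiOp u i j) (yOp_mul_xiOp u _ _) (tOp_mul_xiOp t k j)
      ((isSpinFamily_tOp h.toIsSpinFamily).mul_bracket k i j)

theorem yOp_comm (h : IsSpinPolyRep t y) (u : ℂ) (i j : Fin n) :
    yOp t y u i * yOp t y u j = yOp t y u j * yOp t y u i := by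
  refine end_eq id 1 (fun v => ?_) fun k => ?_
  · have := LinearMap.congr_fun (h.y_comm i j) v
    simp only [Module.End.mul_apply] at this
    simp [yOp_one_tmul, this]
  · exact commute_defect (yOp_mul_xiOp u i k) (yOp_mul_xiOp u j k)
      (bracket_jacobi (tOp_mul_yOp h u) i j k)

/-- The induced representation of the spin double affine Hecke algebra on
`𝒞[ξ_1, …, ξ_n] ⊗ N`. -/
def rep (h : IsSpinPolyRep t y) (u : ℂ) :
    SDaHa n u →ₐ[ℂ] Module.End ℂ (SkewPoly n ⊗[ℂ] N) :=
  RingQuot.liftAlgHom ℂ ⟨FreeAlgebra.lift ℂ fun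
    | Gen.xi i => xiOp N i
    | Gen.y i => yOp t y u i
    | Gen.t k => tOp t k, by
    have ht := isSpinFamily_tOp h.toIsSpinFamily
    intro a b r
    induction r with
    | t_sq i => simpa using ht.sq i
    | t_braid i j h => simpa using ht.braid i j h
    | t_anticomm i j h => simpa using ht.anticomm i j h
    | xi_anticomm i j h => simpa using xiOp_anticomm h
    | y_comm i j _ => simpa using yOp_comm h u i j
    | t_xi i => simpa [adj_lo] using tOp_mul_xiOp t i (lo i)
    | t_y i => simpa [adj_lo] using tOp_mul_yOp h u i (lo i)
    | t_xi_far j i h₁ h₂ => simpa [adj_of_ne h₁ h₂] using tOp_mul_xiOp t j i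
    | t_y_far j i h₁ h₂ => simpa [adj_of_ne h₁ h₂] using tOp_mul_yOp h u j i
    | y_xi i j hij =>
      have e := map_oddTransposition (t := ft) (FreeAlgebra.lift ℂ fun
        | Gen.xi i => xiOp N i
        | Gen.y i => yOp t y u i
        | Gen.t k => tOp t k).toRingHom i j
      have := yOp_mul_xiOp (t := t) (y := y) u i j
      rw [bracket_of_ne hij] at this
      simp only [AlgHom.toRingHom_eq_coe, RingHom.coe_coe, FreeAlgebra.lift_ι_apply] at e
      simp [e, this]
    | y_xi_self i =>
      have e := map_bracket (t := ft) (FreeAlgebra.lift ℂ fun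
        | Gen.xi i => xiOp N i
        | Gen.y i => yOp t y u i
        | Gen.t k => tOp t k).toRingHom i i
      have := yOp_mul_xiOp (t := t) (y := y) u i i
      rw [bracket_self] at e
      simp only [AlgHom.toRingHom_eq_coe, RingHom.coe_coe, FreeAlgebra.lift_ι_apply] at e
      rw [map_smul, e]
      simp [this]⟩

@[simp] theorem rep_xi (h : IsSpinPolyRep t y) (u : ℂ) (i : Fin n) :
    rep h u (SDaHa.xi u i) = xiOp N i := by simp [rep, SDaHa.xi]

@[simp] theorem rep_y (h : IsSpinPolyRep t y) (u : ℂ) (i : Fin n) :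
    rep h u (SDaHa.y u i) = yOp t y u i := by simp [rep, SDaHa.y]

@[simp] theorem rep_t (h : IsSpinPolyRep t y) (u : ℂ) (k : Fin (n - 1)) :
    rep h u (SDaHa.t u k) = tOp t k := by simp [rep, SDaHa.t]

end Induced

/-! ### The spin symmetric group algebra -/

namespace SpinSym

variable {n : ℕ}

/-- The universal property of the spin symmetric group algebra. -/
def lift {A : Type*} [Ring A] [Algebra ℂ A] {T : Fin (n - 1) → A} (hT : IsSpinFamily T) :
    SpinSym n →ₐ[ℂ] A :=
  RingQuot.liftAlgHom ℂ ⟨FreeAlgebra.lift ℂ T, by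
    intro a b h
    induction h with
    | sq i => simpa using hT.sq i
    | braid i j h => simpa using hT.braid i j h
    | anticomm i j h => simpa using hT.anticomm i j h⟩

@[simp] theorem lift_t {A : Type*} [Ring A] [Algebra ℂ A] {T : Fin (n - 1) → A}
    (hT : IsSpinFamily T) (k : Fin (n - 1)) : lift hT (t k) = T k := by
  simp [lift, t]

theorem isSpinFamily_t : IsSpinFamily (t : Fin (n - 1) → SpinSym n) where
  sq i := by
    simpa only [t, map_mul, map_one] using RingQuot.mkAlgHom_rel ℂ (SpinRel.sq i)
  braid i j h := by
    simpa only [t, map_mul] using RingQuot.mkAlgHom_rel ℂ (SpinRel.braid i j h)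
  anticomm i j h := by
    simpa only [t, map_mul, map_neg] using RingQuot.mkAlgHom_rel ℂ (SpinRel.anticomm i j h)

theorem t_anticomm {i j : Fin (n - 1)} (h : (i : ℕ) + 1 < j ∨ (j : ℕ) + 1 < i) :
    (t i * t j : SpinSym n) = (-1 : ℂ) • (t j * t i) :=
  (isSpinFamily_t.anticomm i j h).trans (neg_one_smul ℂ (t j * t i : SpinSym n)).symm

/-- Half the sum of squares, the quadratic form for which the difference of two coordinate vectors
has norm `1`. -/
def halfSq (n : ℕ) : QuadraticForm ℂ (Fin n → ℂ) :=
  QuadraticMap.weightedSumSquares ℂ fun _ : Fin n => (1 / 2 : ℂ)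

/-- The simple root `e_k - e_{k+1}`. -/
def root (k : Fin (n - 1)) : Fin n → ℂ := Pi.single (lo k) 1 - Pi.single (hi k) 1

theorem halfSq_root (k : Fin (n - 1)) : halfSq n (root k) = 1 := by
  have h : lo k ≠ hi k := by simp [lo, hi, Fin.ext_iff]
  rw [halfSq, QuadraticMap.weightedSumSquares_apply, Finset.sum_eq_add (lo k) (hi k) h]
  · simp [root, h, h.symm]; norm_num
  · intro c _ hc
    simp [root, Pi.single_eq_of_ne hc.1, Pi.single_eq_of_ne hc.2]
  · simp
  · simp

theorem polar_halfSq (v w : Fin n → ℂ) :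
    QuadraticMap.polar (halfSq n) v w = ∑ i, v i * w i := by
  simp only [QuadraticMap.polar, halfSq, QuadraticMap.weightedSumSquares_apply, Pi.add_apply,
    ← Finset.sum_sub_distrib]
  refine Finset.sum_congr rfl fun i _ => ?_
  simp only [smul_eq_mul]
  ring

theorem polar_root (k l : Fin (n - 1)) :
    QuadraticMap.polar (halfSq n) (root k) (root l) = root l (lo k) - root l (hi k) := by
  rw [polar_halfSq]
  simp [root, sub_mul, Finset.sum_sub_distrib, Pi.single_apply]

/-- The simple roots generate a copy of the spin relations inside the Clifford algebra. -/
theorem isSpinFamily_clifford :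
    IsSpinFamily fun k : Fin (n - 1) => CliffordAlgebra.ι (halfSq n) (root k) where
  sq i := by rw [CliffordAlgebra.ι_sq_scalar, halfSq_root, map_one]
  braid i j h := by
    have hp : QuadraticMap.polar (halfSq n) (root i) (root j) = -1 := by
      have e : lo j = hi i := Fin.ext h
      have h₁ : lo i ≠ hi i := by simp [lo, hi, Fin.ext_iff]
      have h₂ : lo i ≠ hi j := by simp only [lo, hi, ne_eq, Fin.ext_iff]; omega
      have h₃ : hi i ≠ hi j := by simp only [hi, ne_eq, Fin.ext_iff]; omega
      rw [polar_root]
      simp [root, e, h₁, h₂, h₃]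
    have hs := CliffordAlgebra.ι_mul_ι_add_swap (Q := halfSq n) (root i) (root j)
    have hi := CliffordAlgebra.ι_sq_scalar (halfSq n) (root i)
    have hj := CliffordAlgebra.ι_sq_scalar (halfSq n) (root j)
    rw [hp, map_neg, map_one] at hs
    rw [halfSq_root, map_one] at hi hj
    -- both sides are `-a - b` for `a² = b² = 1` and `a b + b a = -1`
    generalize CliffordAlgebra.ι (halfSq n) (root i) = a at hs hi
    generalize CliffordAlgebra.ι (halfSq n) (root j) = b at hs hj
    have hab : a * b = -1 - b * a := eq_sub_of_add_eq hs
    have h₁ : a * b * a = -a - b := by rw [hab, sub_mul, mul_assoc, hi]; simp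
    have h₂ : b * a * b = -b - a := by
      rw [mul_assoc, hab, mul_sub, ← mul_assoc, hj]; simp
    rw [h₁, h₂]; abel
  anticomm i j h := by
    refine eq_neg_of_add_eq_zero_left ?_
    rw [CliffordAlgebra.ι_mul_ι_add_swap, polar_root]
    have h₁ : lo i ≠ lo j := by simp only [lo, ne_eq, Fin.ext_iff]; omega
    have h₂ : lo i ≠ hi j := by simp only [lo, hi, ne_eq, Fin.ext_iff]; omega
    have h₃ : hi i ≠ lo j := by simp only [lo, hi, ne_eq, Fin.ext_iff]; omega
    have h₄ : hi i ≠ hi j := by simp only [hi, ne_eq, Fin.ext_iff]; omega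
    simp [root, h₁, h₂, h₃, h₄]

/-- The defining relations of `ℂ S_n^-` do not collapse it, because it maps to a Clifford
algebra. -/
instance : Nontrivial (SpinSym n) :=
  haveI : Invertible (2 : ℂ) := invertibleOfNonzero two_ne_zero
  (lift (isSpinFamily_clifford (n := n))).toRingHom.domain_nontrivial

end SpinSym

/-! ### Straightening products of polynomials and spin permutations -/

namespace Straighten

variable {n : ℕ}

/-- The group structure whose addition is syntactically that of the tensor product. -/
instance : AddCommGroup (MvPolynomial (Fin n) ℂ ⊗[ℂ] SpinSym n) :=
  Module.addCommMonoidToAddCommGroup ℂ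

/-- The group structure whose addition is syntactically that of the tensor product. -/
instance : AddCommGroup (SpinSym n ⊗[ℂ] MvPolynomial (Fin n) ℂ) :=
  Module.addCommMonoidToAddCommGroup ℂ

/-- The permutation of variables induced by `s_k`. -/
def permVar (k : Fin (n - 1)) : MvPolynomial (Fin n) ℂ →ₐ[ℂ] MvPolynomial (Fin n) ℂ :=
  MvPolynomial.rename (adj k)

theorem permVar_X (k : Fin (n - 1)) (i : Fin n) :
    permVar k (MvPolynomial.X i) = MvPolynomial.X (adj k i) := MvPolynomial.rename_X _ _

theorem permVar_permVar (k : Fin (n - 1)) (g : MvPolynomial (Fin n) ℂ) :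
    permVar k (permVar k g) = g := by
  rw [permVar, MvPolynomial.rename_rename, ← Equiv.Perm.coe_mul, adj_mul_self, Equiv.Perm.coe_one,
    MvPolynomial.rename_id_apply]

theorem permVar_braid {i j : Fin (n - 1)} (h : (j : ℕ) = i + 1) (g : MvPolynomial (Fin n) ℂ) :
    permVar i (permVar j (permVar i g)) = permVar j (permVar i (permVar j g)) := by
  simp only [permVar, MvPolynomial.rename_rename, ← Equiv.Perm.coe_mul, ← mul_assoc, adj_braid h]

theorem permVar_comm {i j : Fin (n - 1)} (h : (i : ℕ) + 1 < j ∨ (j : ℕ) + 1 < i)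
    (g : MvPolynomial (Fin n) ℂ) : permVar i (permVar j g) = permVar j (permVar i g) := by
  simp only [permVar, MvPolynomial.rename_rename, ← Equiv.Perm.coe_mul, adj_commute h]

/-- The operator `t_k` on `ℂ[y] ⊗ ℂ S_n^-`, seen as the algebra generated by the `y_i` and the `t_k`
with polynomials written first. -/
def leftT (k : Fin (n - 1)) : Module.End ℂ (MvPolynomial (Fin n) ℂ ⊗[ℂ] SpinSym n) :=
  TensorProduct.map (permVar k).toLinearMap (LinearMap.mulLeft ℂ (SpinSym.t k))

@[simp] theorem leftT_tmul (k : Fin (n - 1)) (g : MvPolynomial (Fin n) ℂ) (σ : SpinSym n) :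
    leftT k (g ⊗ₜ σ) = permVar k g ⊗ₜ (SpinSym.t k * σ) := rfl

/-- The operator `y_i` on `ℂ[y] ⊗ ℂ S_n^-`. -/
def leftY (i : Fin n) : Module.End ℂ (MvPolynomial (Fin n) ℂ ⊗[ℂ] SpinSym n) :=
  LinearMap.rTensor _ (LinearMap.mulLeft ℂ (MvPolynomial.X i))

@[simp] theorem leftY_tmul (i : Fin n) (g : MvPolynomial (Fin n) ℂ) (σ : SpinSym n) :
    leftY i (g ⊗ₜ σ) = (MvPolynomial.X i * g) ⊗ₜ σ := rfl

theorem isSpinPolyRep : IsSpinPolyRep (leftT (n := n)) leftY where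
  sq i := TensorProduct.ext' fun g σ => by
    simp [permVar_permVar, SpinSym.isSpinFamily_t.sq_mul]
  braid i j h := TensorProduct.ext' fun g σ => by
    simp only [Module.End.mul_apply, leftT_tmul, permVar_braid h, ← mul_assoc,
      SpinSym.isSpinFamily_t.braid i j h]
  anticomm i j h := TensorProduct.ext' fun g σ => by
    simp only [Module.End.mul_apply, leftT_tmul, permVar_comm h, ← mul_assoc, LinearMap.neg_apply,
      SpinSym.t_anticomm h, smul_mul_assoc, TensorProduct.tmul_smul, neg_one_smul]
  y_comm i j := TensorProduct.ext' fun g σ => by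
    simp only [Module.End.mul_apply, leftY_tmul, mul_left_comm]
  t_y k i := TensorProduct.ext' fun g σ => by
    simp [permVar_X]

/-- Left multiplication of `ℂ S_n^-` on `ℂ[y] ⊗ ℂ S_n^-`. -/
def leftAct : SpinSym n →ₐ[ℂ] Module.End ℂ (MvPolynomial (Fin n) ℂ ⊗[ℂ] SpinSym n) :=
  SpinSym.lift isSpinPolyRep.toIsSpinFamily

/-- Right multiplication by `t_k` on `ℂ S_n^- ⊗ ℂ[y]`, with polynomials written last. -/
def rightT (k : Fin (n - 1)) : Module.End ℂ (SpinSym n ⊗[ℂ] MvPolynomial (Fin n) ℂ) :=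
  TensorProduct.map (LinearMap.mulRight ℂ (SpinSym.t k)) (permVar k).toLinearMap

@[simp] theorem rightT_tmul (k : Fin (n - 1)) (σ : SpinSym n) (g : MvPolynomial (Fin n) ℂ) :
    rightT k (σ ⊗ₜ g) = (σ * SpinSym.t k) ⊗ₜ permVar k g := rfl

theorem isSpinFamily_rightT : IsSpinFamily fun k => MulOpposite.op (rightT (n := n) k) where
  sq i := MulOpposite.unop_injective <| TensorProduct.ext' fun σ g => by
    simp [permVar_permVar, mul_assoc, SpinSym.isSpinFamily_t.sq]
  braid i j h := MulOpposite.unop_injective <| TensorProduct.ext' fun σ g => by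
    simp only [MulOpposite.unop_mul, MulOpposite.unop_op, Module.End.mul_apply, rightT_tmul,
      permVar_braid h, mul_assoc]
    simp only [← mul_assoc (SpinSym.t _), SpinSym.isSpinFamily_t.braid i j h]
  anticomm i j h := MulOpposite.unop_injective <| TensorProduct.ext' fun σ g => by
    simp only [MulOpposite.unop_mul, MulOpposite.unop_op, MulOpposite.unop_neg,
      Module.End.mul_apply, rightT_tmul, permVar_comm h, mul_assoc, LinearMap.neg_apply,
      SpinSym.t_anticomm h, mul_smul_comm, ← TensorProduct.smul_tmul', neg_one_smul]

/-- Right multiplication of `ℂ S_n^-` on `ℂ S_n^- ⊗ ℂ[y]`. -/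
def rightAct : SpinSym n →ₐ[ℂ] (Module.End ℂ (SpinSym n ⊗[ℂ] MvPolynomial (Fin n) ℂ))ᵐᵒᵖ :=
  SpinSym.lift isSpinFamily_rightT

/-- Rewriting of a product `g σ` with the polynomial last: `g ⊗ σ ↦ (1 ⊗ g) · σ`. -/
def straighten :
    MvPolynomial (Fin n) ℂ ⊗[ℂ] SpinSym n →ₗ[ℂ] SpinSym n ⊗[ℂ] MvPolynomial (Fin n) ℂ :=
  TensorProduct.lift (LinearMap.mk₂ ℂ (fun g σ => (rightAct σ).unop (1 ⊗ₜ g))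
    (fun g h σ => by rw [TensorProduct.tmul_add, map_add])
    (fun c g σ => by rw [TensorProduct.tmul_smul, map_smul])
    (fun g σ τ => by rw [map_add, MulOpposite.unop_add, LinearMap.add_apply])
    (fun c g σ => by rw [map_smul, MulOpposite.unop_smul, LinearMap.smul_apply]))

theorem straighten_tmul (g : MvPolynomial (Fin n) ℂ) (σ : SpinSym n) :
    straighten (g ⊗ₜ σ) = (rightAct σ).unop (1 ⊗ₜ g) := rfl

/-- Left and right multiplication commute. -/
theorem rightAct_mul_left (τ σ : SpinSym n) (w : SpinSym n ⊗[ℂ] MvPolynomial (Fin n) ℂ) :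
    (rightAct σ).unop (LinearMap.rTensor _ (LinearMap.mulLeft ℂ τ) w) =
      LinearMap.rTensor _ (LinearMap.mulLeft ℂ τ) ((rightAct σ).unop w) := by
  let p : Submodule ℂ (SpinSym n) :=
    { carrier := {σ | ∀ w, (rightAct σ).unop (LinearMap.rTensor _ (LinearMap.mulLeft ℂ τ) w) =
        LinearMap.rTensor _ (LinearMap.mulLeft ℂ τ) ((rightAct σ).unop w)}
      zero_mem' := by simp
      add_mem' := fun {a b} ha hb w => by
        rw [map_add, MulOpposite.unop_add, LinearMap.add_apply, LinearMap.add_apply, ha, hb,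
          map_add]
      smul_mem' := fun c a ha w => by
        rw [map_smul, MulOpposite.unop_smul, LinearMap.smul_apply, LinearMap.smul_apply, ha,
          map_smul] }
  have hp : p = ⊤ := by
    refine submodule_eq_top (fun w => by simp) fun k a ha w => ?_
    have hk : (rightAct (SpinSym.t k)).unop = rightT k := by simp [rightAct]
    change (rightAct (SpinSym.t k * a)).unop _ = LinearMap.rTensor _ (LinearMap.mulLeft ℂ τ)
      ((rightAct (SpinSym.t k * a)).unop _)
    rw [map_mul, MulOpposite.unop_mul, hk, Module.End.mul_apply, Module.End.mul_apply, ← ha]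
    congr 1
    induction w with
    | zero => simp
    | add v w hv hw => simp only [map_add, hv, hw]
    | tmul σ g => simp [mul_assoc]
  exact (hp ▸ Submodule.mem_top : σ ∈ p) w

theorem straighten_leftT (k : Fin (n - 1)) (v : MvPolynomial (Fin n) ℂ ⊗[ℂ] SpinSym n) :
    straighten (leftT k v) =
      LinearMap.rTensor _ (LinearMap.mulLeft ℂ (SpinSym.t k)) (straighten v) := by
  induction v with
  | zero => simp
  | add v w hv hw => simp only [map_add, hv, hw]
  | tmul g σ =>
    have hk : (rightAct (SpinSym.t k)).unop = rightT k := by simp [rightAct]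
    rw [leftT_tmul, straighten_tmul, straighten_tmul, ← rightAct_mul_left, map_mul,
      MulOpposite.unop_mul, hk, Module.End.mul_apply, rightT_tmul, permVar_permVar]
    simp

/-- Straightening undoes the passage from `σ ⊗ g` to `σ · (g ⊗ 1)`, so the latter is injective. -/
theorem straighten_leftAct (σ : SpinSym n) (g : MvPolynomial (Fin n) ℂ) :
    straighten (leftAct σ (g ⊗ₜ 1)) = σ ⊗ₜ g := by
  let p : Submodule ℂ (SpinSym n) :=
    { carrier := {σ | straighten (leftAct σ (g ⊗ₜ 1)) = σ ⊗ₜ g}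
      zero_mem' := by simp
      add_mem' := fun {a b} ha hb => by
        rw [Set.mem_ofPred_eq] at *
        rw [map_add, LinearMap.add_apply, map_add, ha, hb, TensorProduct.add_tmul]
      smul_mem' := fun c a ha => by
        rw [Set.mem_ofPred_eq] at *
        rw [map_smul, LinearMap.smul_apply, map_smul, ha, TensorProduct.smul_tmul'] }
  have hp : p = ⊤ := by
    refine submodule_eq_top (by simp [p, straighten_tmul]) fun k a ha => ?_
    have hk : leftAct (SpinSym.t k) = leftT k := by simp [leftAct]
    change straighten (leftAct (SpinSym.t k * a) _) = (SpinSym.t k * a) ⊗ₜ g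
    rw [map_mul, Module.End.mul_apply, hk, straighten_leftT, show straighten _ = _ from ha]
    simp
  exact (hp ▸ Submodule.mem_top : σ ∈ p)

end Straighten

/-! ### Relations and products in the double affine Hecke algebra -/

namespace SDaHa

variable {n : ℕ} (u : ℂ)

theorem isSpinFamily_t : IsSpinFamily (t u : Fin (n - 1) → SDaHa n u) where
  sq i := by
    simpa only [t, map_mul, map_one] using RingQuot.mkAlgHom_rel ℂ (Rel.t_sq (u := u) i)
  braid i j h := by
    simpa only [t, map_mul] using RingQuot.mkAlgHom_rel ℂ (Rel.t_braid (u := u) i j h)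
  anticomm i j h := by
    simpa only [t, map_mul, map_neg] using RingQuot.mkAlgHom_rel ℂ (Rel.t_anticomm (u := u) i j h)

theorem t_mul_xi (k : Fin (n - 1)) (i : Fin n) :
    t u k * xi u i = -(xi u (adj k i) * t u k) := by
  have h : t u k * xi u (lo k) = -(xi u (hi k) * t u k) := by
    simpa only [t, xi, map_mul, map_neg] using RingQuot.mkAlgHom_rel ℂ (Rel.t_xi (u := u) k)
  by_cases h₁ : i = lo k
  · rw [h₁, adj_lo, h]
  by_cases h₂ : i = hi k
  · rw [h₂, adj_hi]
    exact (isSpinFamily_t u).mul_anticomm_of_mul_anticomm h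
  · rw [adj_of_ne h₁ h₂]
    simpa only [t, xi, map_mul, map_neg] using
      RingQuot.mkAlgHom_rel ℂ (Rel.t_xi_far (u := u) k i h₁ h₂)

theorem t_mul_y (k : Fin (n - 1)) (i : Fin n) : t u k * y u i = y u (adj k i) * t u k := by
  have h : t u k * y u (lo k) = y u (hi k) * t u k := by
    simpa only [t, y, map_mul] using RingQuot.mkAlgHom_rel ℂ (Rel.t_y (u := u) k)
  by_cases h₁ : i = lo k
  · rw [h₁, adj_lo, h]
  by_cases h₂ : i = hi k
  · rw [h₂, adj_hi, (isSpinFamily_t u).mul_comm_of_mul_comm h]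
  · rw [adj_of_ne h₁ h₂]
    simpa only [t, y, map_mul] using RingQuot.mkAlgHom_rel ℂ (Rel.t_y_far (u := u) k i h₁ h₂)

theorem y_mul_xi (i j : Fin n) :
    y u i * xi u j = xi u j * y u i + u • bracket (t u) i j := by
  have e := map_bracket (t := ft) (RingQuot.mkAlgHom ℂ (Rel n u)).toRingHom i j
  change RingQuot.mkAlgHom ℂ (Rel n u) _ = bracket (t u) i j at e
  rw [← sub_eq_iff_eq_add']
  by_cases h : i = j
  · subst h
    rw [bracket_self] at e
    have := RingQuot.mkAlgHom_rel ℂ (Rel.y_xi_self (u := u) i)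
    rwa [map_smul, e, map_sub, map_mul, map_mul] at this
  · rw [bracket_of_ne h] at e
    have := RingQuot.mkAlgHom_rel ℂ (Rel.y_xi (u := u) i j h)
    rwa [map_smul, e, map_sub, map_mul, map_mul] at this

/-- The multiplication map `f ⊗ σ ⊗ g ↦ f σ g`. -/
def mulMap : SkewPoly n ⊗[ℂ] SpinSym n ⊗[ℂ] MvPolynomial (Fin n) ℂ →ₗ[ℂ] SDaHa n u :=
  LinearMap.mul' ℂ _ ∘ₗ TensorProduct.map
    (LinearMap.mul' ℂ _ ∘ₗ TensorProduct.map (ofSkewPoly u).toLinearMap (ofSpinSym u).toLinearMap)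
    (ofPoly u).toLinearMap

@[simp] theorem mulMap_tmul (f : SkewPoly n) (σ : SpinSym n) (g : MvPolynomial (Fin n) ℂ) :
    mulMap u (f ⊗ₜ σ ⊗ₜ g) = ofSkewPoly u f * ofSpinSym u σ * ofPoly u g := rfl

/-! ### Linear independence -/

section LeftInverse

open Induced Straighten

theorem rep_ofSkewPoly (f : SkewPoly n) :
    rep (isSpinPolyRep (n := n)) u (ofSkewPoly u f) = mulOp _ f := by
  have : (rep (isSpinPolyRep (n := n)) u).comp (ofSkewPoly u) =
      mulOp (MvPolynomial (Fin n) ℂ ⊗[ℂ] SpinSym n) :=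
    SkewPoly.algHom_ext fun i => by
      rw [AlgHom.comp_apply, ofSkewPoly_xi, rep_xi, xiOp]
  exact DFunLike.congr_fun this f

theorem rep_ofSpinSym (σ : SpinSym n) (v : MvPolynomial (Fin n) ℂ ⊗[ℂ] SpinSym n) :
    rep isSpinPolyRep u (ofSpinSym u σ) (1 ⊗ₜ v) = 1 ⊗ₜ leftAct σ v := by
  let p : Submodule ℂ (SpinSym n) :=
    { carrier := {σ | rep isSpinPolyRep u (ofSpinSym u σ) (1 ⊗ₜ v) = 1 ⊗ₜ leftAct σ v}
      zero_mem' := by simp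
      add_mem' := fun {a b} ha hb => by
        rw [Set.mem_ofPred_eq] at *
        rw [map_add, map_add, map_add, LinearMap.add_apply, LinearMap.add_apply, ha, hb,
          TensorProduct.tmul_add]
      smul_mem' := fun c a ha => by
        rw [Set.mem_ofPred_eq] at *
        rw [map_smul, map_smul, map_smul, LinearMap.smul_apply, LinearMap.smul_apply, ha,
          TensorProduct.tmul_smul] }
  have hp : p = ⊤ := by
    refine submodule_eq_top (by simp [p]) fun k a ha => ?_
    have hk : leftAct (SpinSym.t k) = leftT k := by simp [leftAct]
    change rep isSpinPolyRep u (ofSpinSym u (SpinSym.t k * a)) (1 ⊗ₜ v) =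
      1 ⊗ₜ leftAct (SpinSym.t k * a) v
    rw [map_mul, map_mul, map_mul, Module.End.mul_apply, Module.End.mul_apply,
      show rep isSpinPolyRep u (ofSpinSym u a) (1 ⊗ₜ v) = _ from ha, hk, ofSpinSym_t, rep_t,
      tOp_tmul, map_one]
  exact (hp ▸ Submodule.mem_top : σ ∈ p)

theorem rep_ofPoly (g : MvPolynomial (Fin n) ℂ) :
    rep isSpinPolyRep u (ofPoly u g) (1 ⊗ₜ (1 ⊗ₜ 1)) = 1 ⊗ₜ (g ⊗ₜ (1 : SpinSym n)) := by
  induction g using MvPolynomial.induction_on with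
  | C c =>
    rw [← MvPolynomial.algebraMap_eq, AlgHom.commutes, AlgHom.commutes,
      Module.algebraMap_end_apply, Algebra.algebraMap_eq_smul_one, ← TensorProduct.smul_tmul',
      TensorProduct.tmul_smul]
  | add g h hg hh =>
    rw [map_add, map_add, LinearMap.add_apply, hg, hh, TensorProduct.add_tmul,
      TensorProduct.tmul_add]
  | mul_X g i hg =>
    rw [mul_comm, map_mul, map_mul, Module.End.mul_apply, hg, ofPoly_X, rep_y, yOp_one_tmul,
      leftY_tmul]

/-- The action of `f σ g` on the cyclic vector of the induced representation determines
`f ⊗ σ ⊗ g`. -/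
theorem mulMap_injective : Function.Injective (mulMap u : _ →ₗ[ℂ] SDaHa n u) := by
  let Λ : SDaHa n u →ₗ[ℂ] SkewPoly n ⊗[ℂ] SpinSym n ⊗[ℂ] MvPolynomial (Fin n) ℂ :=
    (TensorProduct.assoc ℂ _ _ _).symm.toLinearMap ∘ₗ LinearMap.lTensor _ straighten ∘ₗ
      LinearMap.applyₗ (1 ⊗ₜ (1 ⊗ₜ 1)) ∘ₗ (rep isSpinPolyRep u).toLinearMap
  have h : Λ ∘ₗ mulMap u = LinearMap.id := by
    refine TensorProduct.ext_threefold fun f σ g => ?_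
    have : rep isSpinPolyRep u (mulMap u (f ⊗ₜ σ ⊗ₜ g)) (1 ⊗ₜ (1 ⊗ₜ 1)) =
        f ⊗ₜ leftAct σ (g ⊗ₜ 1) := by
      rw [mulMap_tmul, map_mul, map_mul, Module.End.mul_apply, Module.End.mul_apply, rep_ofPoly,
        rep_ofSpinSym, rep_ofSkewPoly, mulOp_tmul, mul_one]
    change (TensorProduct.assoc ℂ _ _ _).symm (LinearMap.lTensor _ straighten
      (rep isSpinPolyRep u (mulMap u (f ⊗ₜ σ ⊗ₜ g)) (1 ⊗ₜ (1 ⊗ₜ 1)))) = f ⊗ₜ σ ⊗ₜ g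
    rw [this, LinearMap.lTensor_tmul, straighten_leftAct, TensorProduct.assoc_symm_tmul]
  exact Function.LeftInverse.injective (g := Λ) (LinearMap.congr_fun h)

end LeftInverse

/-! ### Spanning -/

section Spanning

theorem mulMap_mem (f : SkewPoly n) (σ : SpinSym n) (g : MvPolynomial (Fin n) ℂ) :
    ofSkewPoly u f * ofSpinSym u σ * ofPoly u g ∈ LinearMap.range (mulMap u) :=
  ⟨_, mulMap_tmul u f σ g⟩

/-- Stability of the range of the multiplication map under left multiplication may be checked on
the products `f σ g`. -/
theorem mul_mem_range {a : SDaHa n u}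
    (h : ∀ f σ g, a * (ofSkewPoly u f * ofSpinSym u σ * ofPoly u g) ∈ LinearMap.range (mulMap u))
    {b : SDaHa n u} (hb : b ∈ LinearMap.range (mulMap u)) :
    a * b ∈ LinearMap.range (mulMap u) := by
  obtain ⟨x, rfl⟩ := hb
  induction x with
  | zero => simp
  | add x z hx hz => rw [map_add, mul_add]; exact add_mem hx hz
  | tmul x g =>
    induction x with
    | zero => simp
    | add x z hx hz => rw [TensorProduct.add_tmul, map_add, mul_add]; exact add_mem hx hz
    | tmul f σ => exact h f σ g

theorem xi_mul_mem_range (i : Fin n) {b : SDaHa n u} (hb : b ∈ LinearMap.range (mulMap u)) :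
    xi u i * b ∈ LinearMap.range (mulMap u) := by
  refine mul_mem_range u (fun f σ g => ?_) hb
  rw [← ofSkewPoly_xi, ← mul_assoc, ← mul_assoc, ← map_mul]
  exact mulMap_mem u _ _ _

theorem t_mul_mem_range (k : Fin (n - 1)) {b : SDaHa n u}
    (hb : b ∈ LinearMap.range (mulMap u)) : t u k * b ∈ LinearMap.range (mulMap u) := by
  have key (f : SkewPoly n) : t u k * ofSkewPoly u f =
      ofSkewPoly u (SkewPoly.twist (adj k) (-1) f) * t u k := by
    let p : Submodule ℂ (SkewPoly n) := LinearMap.eqLocus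
      (LinearMap.mulLeft ℂ (t u k) ∘ₗ (ofSkewPoly u).toLinearMap)
      (LinearMap.mulRight ℂ (t u k) ∘ₗ (ofSkewPoly u).toLinearMap ∘ₗ
        (SkewPoly.twist (adj k) (-1)).toLinearMap)
    have hp : p = ⊤ := by
      refine submodule_eq_top (by simp [p]) fun i a ha => ?_
      have ha : t u k * ofSkewPoly u a =
        ofSkewPoly u (SkewPoly.twist (adj k) (-1) a) * t u k := ha
      change t u k * ofSkewPoly u (SkewPoly.xi i * a) =
        ofSkewPoly u (SkewPoly.twist (adj k) (-1) (SkewPoly.xi i * a)) * t u k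
      rw [map_mul, map_mul, SkewPoly.twist_xi, map_mul, map_smul, ofSkewPoly_xi, ofSkewPoly_xi,
        ← mul_assoc,
        (t_mul_xi u k i).trans (neg_one_smul ℂ (_ : SDaHa n u)).symm]
      simp only [smul_mul_assoc, mul_assoc, ha]
    exact (hp ▸ Submodule.mem_top : f ∈ p)
  refine mul_mem_range u (fun f σ g => ?_) hb
  rw [← mul_assoc, ← mul_assoc, key, mul_assoc (ofSkewPoly u _), ← ofSpinSym_t, ← map_mul]
  exact mulMap_mem u _ _ _

/-- Moving `y_i` to the right past `f` costs terms `u C_{ij}` with fewer `ξ`, and moving it past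
`σ` only changes its index. -/
theorem y_mul_mem_range (i : Fin n) {b : SDaHa n u} (hb : b ∈ LinearMap.range (mulMap u)) :
    y u i * b ∈ LinearMap.range (mulMap u) := by
  refine mul_mem_range u (fun f σ g => ?_) hb
  -- all indices at once, since passing `t_k` permutes them
  have hσ (i : Fin n) : y u i * (ofSpinSym u σ * ofPoly u g) ∈ LinearMap.range (mulMap u) := by
    let p : Submodule ℂ (SpinSym n) :=
      ⨅ i, (LinearMap.range (mulMap u)).comap (LinearMap.mulLeft ℂ (y u i) ∘ₗ
        LinearMap.mulRight ℂ (ofPoly u g) ∘ₗ (ofSpinSym u).toLinearMap)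
    have hp : p = ⊤ := by
      refine submodule_eq_top ?_ fun k a ha => ?_
      · refine (Submodule.mem_iInf _).2 fun i => ?_
        have := mulMap_mem u 1 1 (MvPolynomial.X i * g)
        simpa using this
      · refine (Submodule.mem_iInf _).2 fun i => ?_
        have ha := (Submodule.mem_iInf _).1 ha (adj k i)
        change y u (adj k i) * (ofSpinSym u a * ofPoly u g) ∈ LinearMap.range (mulMap u) at ha
        change y u i * (ofSpinSym u (SpinSym.t k * a) * ofPoly u g) ∈ LinearMap.range (mulMap u)
        have e := t_mul_y u k (adj k i)
        rw [adj_adj] at e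
        rw [map_mul, ofSpinSym_t, mul_assoc, ← mul_assoc (y u i), ← e, mul_assoc]
        exact t_mul_mem_range u k ha
    exact (Submodule.mem_iInf _).1 (hp ▸ Submodule.mem_top : σ ∈ p) i
  let p : Submodule ℂ (SkewPoly n) :=
    (LinearMap.range (mulMap u)).comap (LinearMap.mulLeft ℂ (y u i) ∘ₗ
      LinearMap.mulRight ℂ (ofSpinSym u σ * ofPoly u g) ∘ₗ (ofSkewPoly u).toLinearMap)
  have hp : p = ⊤ := by
    refine submodule_eq_top ?_ fun j a ha => ?_
    · simpa [p] using hσ i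
    · change y u i * (ofSkewPoly u a * (ofSpinSym u σ * ofPoly u g)) ∈
        LinearMap.range (mulMap u) at ha
      change y u i * (ofSkewPoly u (SkewPoly.xi j * a) * (ofSpinSym u σ * ofPoly u g)) ∈
        LinearMap.range (mulMap u)
      rw [map_mul, ofSkewPoly_xi, mul_assoc, ← mul_assoc (y u i), y_mul_xi, add_mul, mul_assoc,
        smul_mul_assoc]
      refine add_mem (xi_mul_mem_range u j ha)
        (Submodule.smul_mem _ u (bracket_mul_mem (fun k _ => t_mul_mem_range u k) i j ?_))
      rw [← mul_assoc]
      exact mulMap_mem u a σ g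
  rw [mul_assoc (ofSkewPoly u f)]
  exact (hp ▸ Submodule.mem_top : f ∈ p)

theorem mulMap_surjective : Function.Surjective (mulMap u : _ →ₗ[ℂ] SDaHa n u) := by
  refine LinearMap.range_eq_top.1 (submodule_eq_top ?_ fun s a ha => ?_)
  · simpa using mulMap_mem u 1 1 1
  · cases s with
    | xi i => exact xi_mul_mem_range u i ha
    | y i => exact y_mul_mem_range u i ha
    | t k => exact t_mul_mem_range u k ha

end Spanning

/-- The multiplication map as a linear isomorphism. -/
def mulEquiv : SkewPoly n ⊗[ℂ] SpinSym n ⊗[ℂ] MvPolynomial (Fin n) ℂ ≃ₗ[ℂ] SDaHa n u :=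
  LinearEquiv.ofBijective (mulMap u) ⟨mulMap_injective u, mulMap_surjective u⟩

theorem ofSkewPoly_injective :
    Function.Injective (ofSkewPoly u : SkewPoly n →ₐ[ℂ] SDaHa n u) := by
  intro f g h
  have h₁ : f ⊗ₜ[ℂ] (1 : SpinSym n) ⊗ₜ[ℂ] (1 : MvPolynomial (Fin n) ℂ) = g ⊗ₜ 1 ⊗ₜ 1 :=
    mulMap_injective u (by simp [h])
  exact Algebra.TensorProduct.includeLeft_injective (S := ℂ) (algebraMap ℂ (SpinSym n)).injective
    (Algebra.TensorProduct.includeLeft_injective (S := ℂ)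
      (algebraMap ℂ (MvPolynomial (Fin n) ℂ)).injective h₁)

theorem ofSpinSym_injective :
    Function.Injective (ofSpinSym u : SpinSym n →ₐ[ℂ] SDaHa n u) := by
  intro σ τ h
  have h₁ : (1 : SkewPoly n) ⊗ₜ[ℂ] σ ⊗ₜ[ℂ] (1 : MvPolynomial (Fin n) ℂ) = 1 ⊗ₜ τ ⊗ₜ 1 :=
    mulMap_injective u (by simp [h])
  exact Algebra.TensorProduct.includeRight_injective (algebraMap ℂ (SkewPoly n)).injective
    (Algebra.TensorProduct.includeLeft_injective (S := ℂ)
      (algebraMap ℂ (MvPolynomial (Fin n) ℂ)).injective h₁)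

theorem ofPoly_injective :
    Function.Injective (ofPoly u : MvPolynomial (Fin n) ℂ →ₐ[ℂ] SDaHa n u) := by
  intro g g' h
  have h₁ : (1 : SkewPoly n) ⊗ₜ[ℂ] (1 : SpinSym n) ⊗ₜ[ℂ] g = 1 ⊗ₜ 1 ⊗ₜ g' :=
    mulMap_injective u (by simp [h])
  have : Nontrivial (SkewPoly n ⊗[ℂ] SpinSym n) :=
    (Algebra.TensorProduct.includeLeft_injective (S := ℂ) (A := SkewPoly n)
      (algebraMap ℂ (SpinSym n)).injective).nontrivial
  exact Algebra.TensorProduct.includeRight_injective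
    (algebraMap ℂ (SkewPoly n ⊗[ℂ] SpinSym n)).injective h₁

end SDaHa

end SpinDaHa

end

theorem mainTheorem3 (n : ℕ) (u : ℂ) :
    Function.Injective (SpinDaHa.SDaHa.ofSkewPoly u : SpinDaHa.SkewPoly n →ₐ[ℂ] SpinDaHa.SDaHa n u) ∧
    Function.Injective (SpinDaHa.SDaHa.ofSpinSym u : SpinDaHa.SpinSym n →ₐ[ℂ] SpinDaHa.SDaHa n u) ∧
    Function.Injective (SpinDaHa.SDaHa.ofPoly u : MvPolynomial (Fin n) ℂ →ₐ[ℂ] SpinDaHa.SDaHa n u) ∧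
    ∃ e : SpinDaHa.SkewPoly n ⊗[ℂ] SpinDaHa.SpinSym n ⊗[ℂ] MvPolynomial (Fin n) ℂ ≃ₗ[ℂ]
        SpinDaHa.SDaHa n u,
      ∀ (f : SpinDaHa.SkewPoly n) (σ : SpinDaHa.SpinSym n) (g : MvPolynomial (Fin n) ℂ),
        e (f ⊗ₜ[ℂ] σ ⊗ₜ[ℂ] g) =
          SpinDaHa.SDaHa.ofSkewPoly u f * SpinDaHa.SDaHa.ofSpinSym u σ *
            SpinDaHa.SDaHa.ofPoly u g :=
  ⟨SpinDaHa.SDaHa.ofSkewPoly_injective u, SpinDaHa.SDaHa.ofSpinSym_injective u,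
    SpinDaHa.SDaHa.ofPoly_injective u, SpinDaHa.SDaHa.mulEquiv u, SpinDaHa.SDaHa.mulMap_tmul u⟩
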